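/- Let $p$ be a prime, let $m \ge 2$ be an integer, and let $\delta>0$, $\nu>0$, $\epsilon>0$. Then there exists a constant $c = c(\delta,\nu,\epsilon,p,m)>0$ such that the following holds for all positive integers $n$ and $s$. If $\mathcal{A}_1,\dots,\mathcal{A}_s$ are non-empty subsets of $\{0,1\}^n$, each of density $|\mathcal{A}_i|/2^n \ge \delta$, then there exists a subset $Q \subset [s]$ with $|Q| \ge c\,s$ such that for at least $(1-\epsilon)|Q|^m$ of the $m$-tuples $(i_1,\dots,i_m)\in Q^m$ we have, simultaneously for every linear form $\phi:\mathbb{F}_p^n\to\mathbb{F}_p$, \[\omega_{\mathcal{A}_{i_1},\dots,\mathcal{A}_{i_m}}(\phi) \ge 2^{-(m+1)(p-1)}-\nu.\] Here $\{0,1\}^n$ is viewed as a subset of $\mathbb{F}_p^n$, and for non-empty $\mathcal{B}_1,\dots,\mathcal{B}_m\subset\{0,1\}^n$ the overlap is \[\omega_{\mathcal{B}_1,\dots,\mathcal{B}_m}(\phi)=\sum_{d\in\mathbb{F}_p}\min_{1\le t\le m}\mathbb{P}_{x\in\mathcal{B}_t}[\phi(x)=d],\] where $x$ is chosen uniformly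 at random in $\mathcal{B}_t$. -/

import Mathlib

namespace ModPForms

/-- The Boolean cube `{0,1}^n`. -/
abbrev Cube (n : ℕ) : Type := Fin n → Bool

/-- The inclusion of `{0,1}^n` into `𝔽_p^n`. -/
def Cube.toZMod (p : ℕ) {n : ℕ} (x : Cube n) : Fin n → ZMod p :=
  fun z => if x z then 1 else 0

/-- A mod-`p` form in `n` variables: a linear form `𝔽_p^n → 𝔽_p`. -/
abbrev ModPForm (p n : ℕ) : Type := (Fin n → ZMod p) →ₗ[ZMod p] ZMod p

/-- The density of `A` inside `{0,1}^n`. -/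
noncomputable def density {n : ℕ} (A : Finset (Cube n)) : ℝ :=
  (A.card : ℝ) / 2 ^ n

/-- The distribution of `F(x)` for `x` chosen uniformly at random in `A` (for non-empty `A`):
`distr A F d` is the probability that `F(x) = d`. -/
noncomputable def distr {n : ℕ} {D : Type*} [DecidableEq D] (A : Finset (Cube n))
    (F : Cube n → D) (d : D) : ℝ :=
  ((A.filter fun x => F x = d).card : ℝ) / A.card

/-- The overlap of an `m`-tuple of distributions on a finite set `D`, given by their probability
mass functions: `∑ d ∈ D, min (X 1 d, …, X m d)`. For `m ≥ 1` the infimum is a minimum over a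
non-empty finite set. -/
noncomputable def overlap {m : ℕ} {D : Type*} [Fintype D] (X : Fin m → D → ℝ) : ℝ :=
  ∑ d : D, ⨅ t : Fin m, X t d

/-- The overlap of the distributions of the mod-`p` form `φ` on the subsets `A 1, …, A m` of
`{0,1}^n`. -/
noncomputable def formOverlap {p n m : ℕ} [NeZero p] (A : Fin m → Finset (Cube n))
    (φ : ModPForm p n) : ℝ :=
  overlap fun t => distr (A t) fun x => φ (x.toZMod p)

end ModPForms

/-!
The form `φ` is structured on a dense set `A ⊆ {0,1}^n` if `𝔼_{x ∈ A} e^{2πiφ(x)/p}` is not small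
for some multiple of `φ`; otherwise `φ` is almost uniform on `A`. By almost orthogonality, `A` has,
up to scaling and changes of few coordinates, only boundedly many structured forms, and only
boundedly many coordinates correlate with each of these. A maximality argument yields a positive
proportion `Q` of the sets sharing a skeleton of structured forms and correlated coordinates such
that few pairs of `Q` share more than this.

For a tuple with no such pair and any `φ`, either `φ` is structured on at most one of the sets, and
then a popular value on that set has probability about `1/p` on the others, or `φ` is a multiple of
a skeleton form `χ` outside a bounded set of coordinates. After a refinement of `Q`, the value of
`χ` and the coordinates of the skeleton have popular values common to all sets. The other
coordinates on which `φ` differs from `χ` correlate with at most one of the sets, so on each of the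
other sets they are distributed as uniform bits, and a subset sum of `k` elements of `𝔽_p` takes
each of its values with probability at least `2^{-(p-1)}`. Some value of `φ` is thus popular on all
the sets at once.
-/

namespace ModPForms

open Finset ZMod
open scoped BigOperators ComplexConjugate symmDiff

theorem exists_pairwise_not_of_refl_of_symm {α : Type*} (s : Finset α) {R : α → α → Prop}
    (hrefl : ∀ a, R a a) (hsymm : ∀ a b, R a b → R b a) :
    ∃ t ⊆ s, (t : Set α).Pairwise (fun a b => ¬ R a b) ∧ ∀ a ∈ s, ∃ b ∈ t, R a b := by
  classical
  obtain ⟨t, ht, hmax⟩ := exists_max_image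
    (s.powerset.filter fun t : Finset α => (t : Set α).Pairwise fun a b => ¬ R a b)
    Finset.card ⟨∅, by simp⟩
  simp only [mem_filter, mem_powerset] at ht hmax
  refine ⟨t, ht.1, ht.2, fun a ha => ?_⟩
  by_contra! hcon
  have hat : a ∉ t := fun h => hcon a h (hrefl a)
  have hcard := hmax (insert a t) ⟨insert_subset ha ht.1, by
    rw [coe_insert, Set.pairwise_insert]
    exact ⟨ht.2, fun b hb _ => ⟨hcon b hb, fun h => hcon b hb (hsymm b a h)⟩⟩⟩
  rw [card_insert_of_notMem hat] at hcard
  omega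

section Pigeonhole

variable {α β : Type*}

theorem exists_subset_card_le_mul_card {r : α → β → Prop} {s : Finset α} {t : Finset β}
    (ht : t.Nonempty) (h : ∀ a ∈ s, ∃ b ∈ t, r a b) :
    ∃ b ∈ t, ∃ s' ⊆ s, #s ≤ #t * #s' ∧ ∀ a ∈ s', r a b := by
  classical
  have hcover : s ⊆ t.biUnion fun b => {a ∈ s | r a b} := fun a ha => by
    obtain ⟨b, hb, hab⟩ := h a ha
    exact mem_biUnion.2 ⟨b, hb, mem_filter.2 ⟨ha, hab⟩⟩
  have hsum : ∑ _b ∈ t, #s ≤ ∑ b ∈ t, #t * #{a ∈ s | r a b} := by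
    rw [sum_const, smul_eq_mul, ← mul_sum]
    exact Nat.mul_le_mul_left _ ((card_le_card hcover).trans card_biUnion_le)
  obtain ⟨b, hb, hcard⟩ := exists_le_of_sum_le ht hsum
  exact ⟨b, hb, _, filter_subset _ s, hcard, fun a ha => (mem_filter.1 ha).2⟩

open Classical in
theorem exists_mul_card_lt_card_filter {r : α → β → Prop} {s : Finset α} {t : Finset β} {ε : ℝ}
    (h : ε * #s * #t < #(Rel.interedges r s t)) :
    ∃ a ∈ s, ε * #t < #{b ∈ t | r a b} := by
  by_contra! hle
  have hcard : #(Rel.interedges r s t) = ∑ a ∈ s, #{b ∈ t | r a b} := by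
    simp only [Rel.interedges, card_filter, sum_product]
  refine h.not_ge ?_
  calc (#(Rel.interedges r s t) : ℝ) = ∑ a ∈ s, (#{b ∈ t | r a b} : ℝ) := by
        rw [hcard, Nat.cast_sum]
    _ ≤ ∑ _a ∈ s, ε * #t := sum_le_sum hle
    _ = ε * #s * #t := by rw [sum_const, nsmul_eq_mul]; ring

end Pigeonhole

section Refinement

variable {ι σ : Type*} {L : ℕ} {a ε : ℝ}

open Classical in
theorem exists_refinement_of_mul_lt_card_interedges {linked : ι → ι → Prop} {fits : σ → ι → Prop}
    {P : σ → Prop} {Q : Finset ι} (ha : 0 ≤ a) (haε : L * a ≤ ε)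
    (hQ : ε * #Q * #Q < #(Rel.interedges linked Q Q))
    (hrefine : ∀ i ∈ Q, ∃ O : Finset σ, #O ≤ L ∧ (∀ s ∈ O, P s) ∧
      ∀ j ∈ Q, linked i j → ∃ s ∈ O, fits s j) :
    ∃ s, P s ∧ a * #Q ≤ #{j ∈ Q | fits s j} := by
  obtain ⟨i, hi, hiQ⟩ := exists_mul_card_lt_card_filter hQ
  obtain ⟨O, hOL, hOP, hO⟩ := hrefine i hi
  have hε : 0 ≤ ε := (by positivity : 0 ≤ L * a).trans haε
  have hpos : 0 < #{j ∈ Q | linked i j} := by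
    exact_mod_cast (by positivity : 0 ≤ ε * #Q).trans_lt hiQ
  have hO' : ∀ j ∈ ({j ∈ Q | linked i j} : Finset ι), ∃ s ∈ O, fits s j := fun j hj =>
    hO j (mem_filter.1 hj).1 (mem_filter.1 hj).2
  have hOne : O.Nonempty := by
    obtain ⟨j, hj⟩ := card_pos.1 hpos
    obtain ⟨s, hs, -⟩ := hO' j hj
    exact ⟨s, hs⟩
  obtain ⟨s, hs, Q', hQ', hcard, hfits⟩ :=
    exists_subset_card_le_mul_card (r := fun j s => fits s j) hOne hO'
  have hL : 0 < (L : ℝ) := by exact_mod_cast hOne.card_pos.trans_le hOL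
  refine ⟨s, hOP s hs, le_of_mul_le_mul_left ?_ hL⟩
  calc L * (a * #Q) = L * a * #Q := by ring
    _ ≤ ε * #Q := by gcongr
    _ ≤ #{j ∈ Q | linked i j} := hiQ.le
    _ ≤ #O * #Q' := by exact_mod_cast hcard
    _ ≤ L * #{j ∈ Q | fits s j} := by
        gcongr
        exact fun j hj => mem_filter.2 ⟨(mem_filter.1 (hQ' hj)).1, hfits j hj⟩

open Classical in
theorem exists_stable_state {rank : σ → ℕ} {fits : σ → ι → Prop} {linked : σ → ι → ι → Prop}
    {N : ℕ} (ha : 0 ≤ a) (ha₁ : a ≤ 1) (haε : L * a ≤ ε) (hrank : ∀ s j, fits s j → rank s ≤ N)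
    (hrefine : ∀ s i, fits s i → ∃ O : Finset σ, #O ≤ L ∧ (∀ s' ∈ O, rank s < rank s') ∧
      ∀ j, fits s j → linked s i j → ∃ s' ∈ O, fits s' j)
    (k : ℕ) (s₀ : σ) (hk : N < rank s₀ + k) (Q₀ : Finset ι) (hfits : ∀ j ∈ Q₀, fits s₀ j) :
    ∃ s, ∃ Q : Finset ι, a ^ k * #Q₀ ≤ #Q ∧ (∀ j ∈ Q, fits s j) ∧
      #(Rel.interedges (linked s) Q Q) ≤ ε * #Q * #Q := by
  induction k generalizing s₀ Q₀ with
  | zero =>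
    have hempty : Q₀ = ∅ := eq_empty_of_forall_notMem fun j hj =>
      (hrank s₀ j (hfits j hj)).not_gt hk
    exact ⟨s₀, Q₀, by simp, hfits, by simp [hempty]⟩
  | succ k ih =>
    by_cases hstable : #(Rel.interedges (linked s₀) Q₀ Q₀) ≤ ε * #Q₀ * #Q₀
    · exact ⟨s₀, Q₀, mul_le_of_le_one_left (by positivity) (pow_le_one₀ ha ha₁), hfits, hstable⟩
    have hrefine₀ : ∀ i ∈ Q₀, ∃ O : Finset σ, #O ≤ L ∧ (∀ s' ∈ O, rank s₀ < rank s') ∧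
        ∀ j ∈ Q₀, linked s₀ i j → ∃ s' ∈ O, fits s' j := fun i hi => by
      obtain ⟨O, hOL, hOrank, hO⟩ := hrefine s₀ i (hfits i hi)
      exact ⟨O, hOL, hOrank, fun j hj => hO j (hfits j hj)⟩
    obtain ⟨s', hs', hlarge⟩ :=
      exists_refinement_of_mul_lt_card_interedges ha haε (not_le.1 hstable) hrefine₀
    obtain ⟨s, Q, hQ, hstable⟩ := ih s' (by omega) {j ∈ Q₀ | fits s' j}
      fun j hj => (mem_filter.1 hj).2
    refine ⟨s, Q, ?_, hstable⟩
    calc a ^ (k + 1) * #Q₀ = a ^ k * (a * #Q₀) := by ring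
      _ ≤ a ^ k * #{j ∈ Q₀ | fits s' j} := by gcongr
      _ ≤ #Q := hQ

end Refinement

section Tuples

variable {ι τ : Type*} [Fintype τ] [DecidableEq τ]

open Classical in
/-- A tuple with `r (i t) (i t')` is recovered from the pair `(i t, i t')` and from any tuple that
agrees with `i` off `{t, t'}`; the entries of the latter at `t` and `t'` are free. -/
theorem card_filter_piFinset_mul_sq_le (r : ι → ι → Prop) (Q : Finset ι) {t t' : τ}
    (ht : t ≠ t') :
    #{i ∈ Fintype.piFinset fun _ : τ => Q | r (i t) (i t')} * #Q ^ 2 ≤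
      #(Rel.interedges r Q Q) * #Q ^ Fintype.card τ := by
  have hcard : #(Fintype.piFinset fun _ : τ => Q) = #Q ^ Fintype.card τ := by simp
  rw [← hcard, sq, ← card_product, ← card_product, ← card_product]
  refine card_le_card_of_injOn
    (fun q => ((q.1 t, q.1 t'), Function.update (Function.update q.1 t q.2.1) t' q.2.2)) ?_ ?_
  · rintro ⟨i, a, b⟩ h
    simp only [coe_product, Set.mem_prod, mem_coe, mem_filter, Fintype.mem_piFinset] at h
    simp only [coe_product, Set.mem_prod, mem_coe, Rel.mem_interedges_iff, Fintype.mem_piFinset]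
    refine ⟨⟨h.1.1 t, h.1.1 t', h.1.2⟩, fun u => ?_⟩
    simp only [Function.update_apply]
    split_ifs
    exacts [h.2.2, h.2.1, h.1.1 u]
  · rintro ⟨i, a, b⟩ _ ⟨i', a', b'⟩ _ h
    simp only [Prod.mk.injEq] at h
    obtain ⟨⟨hit, hit'⟩, hupd⟩ := h
    have ha := congrFun hupd t
    have hb := congrFun hupd t'
    simp only [Function.update_apply, if_neg ht, if_true] at ha hb
    refine Prod.ext (funext fun u => ?_) (Prod.ext ha hb)
    have hu := congrFun hupd u
    simp only [Function.update_apply] at hu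
    split_ifs at hu with h₁ h₂
    exacts [h₁ ▸ hit', h₂ ▸ hit, hu]

open Classical in
theorem card_filter_piFinset_le {r : ι → ι → Prop} {Q : Finset ι} {ε : ℝ} {t t' : τ} (hε : 0 ≤ ε)
    (h : #(Rel.interedges r Q Q) ≤ ε * #Q * #Q) (ht : t ≠ t') :
    #{i ∈ Fintype.piFinset fun _ : τ => Q | r (i t) (i t')} ≤ ε * #Q ^ Fintype.card τ := by
  rcases Q.eq_empty_or_nonempty with rfl | hQ
  · have hempty : (Fintype.piFinset fun _ : τ => (∅ : Finset ι)) = ∅ :=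
      eq_empty_of_forall_notMem fun i hi => notMem_empty _ (Fintype.mem_piFinset.1 hi t)
    rw [hempty, filter_empty, card_empty, Nat.cast_zero]
    positivity
  have hQpos : (0 : ℝ) < #Q ^ 2 := by have := hQ.card_pos; positivity
  refine le_of_mul_le_mul_right ?_ hQpos
  calc (#{i ∈ Fintype.piFinset fun _ : τ => Q | r (i t) (i t')} : ℝ) * #Q ^ 2
      ≤ #(Rel.interedges r Q Q) * #Q ^ Fintype.card τ := by
        exact_mod_cast card_filter_piFinset_mul_sq_le r Q ht
    _ ≤ ε * #Q * #Q * #Q ^ Fintype.card τ := by gcongr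
    _ = ε * #Q ^ Fintype.card τ * #Q ^ 2 := by ring

open Classical in
theorem mul_card_pow_le_card_filter_pairwise {r : ι → ι → Prop} {Q : Finset ι} {ε : ℝ}
    (hε : 0 ≤ ε) (h : #(Rel.interedges r Q Q) ≤ ε * #Q * #Q) :
    (1 - Fintype.card τ ^ 2 * ε) * #Q ^ Fintype.card τ ≤
      #{i ∈ Fintype.piFinset fun _ : τ => Q | Pairwise fun t t' => ¬ r (i t) (i t')} := by
  set P := Fintype.piFinset fun _ : τ => Q with hP
  have hPcard : #P = #Q ^ Fintype.card τ := by simp [hP]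
  have hpair (q : τ × τ) (_ : q ∈ univ) :
      (#{i ∈ P | q.1 ≠ q.2 ∧ r (i q.1) (i q.2)} : ℝ) ≤ ε * #Q ^ Fintype.card τ := by
    by_cases hq : q.1 = q.2
    · simpa [hq] using (by positivity : 0 ≤ ε * (#Q : ℝ) ^ Fintype.card τ)
    · simpa only [ne_eq, hq, not_false_eq_true, true_and] using card_filter_piFinset_le hε h hq
  have hcover : P ⊆ {i ∈ P | Pairwise fun t t' => ¬ r (i t) (i t')} ∪
      (univ : Finset (τ × τ)).biUnion fun q => {i ∈ P | q.1 ≠ q.2 ∧ r (i q.1) (i q.2)} := by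
    intro i hi
    by_cases hpw : Pairwise fun t t' => ¬ r (i t) (i t')
    · exact mem_union_left _ (mem_filter.2 ⟨hi, hpw⟩)
    · simp only [Pairwise, not_forall, not_not] at hpw
      obtain ⟨t, t', hne, hr⟩ := hpw
      exact mem_union_right _
        (mem_biUnion.2 ⟨(t, t'), mem_univ _, mem_filter.2 ⟨hi, hne, hr⟩⟩)
  have hcount : (#P : ℝ) ≤ #{i ∈ P | Pairwise fun t t' => ¬ r (i t) (i t')} +
      ∑ q : τ × τ, (#{i ∈ P | q.1 ≠ q.2 ∧ r (i q.1) (i q.2)} : ℝ) := by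
    exact_mod_cast (card_le_card hcover).trans
      ((card_union_le _ _).trans (by gcongr; exact card_biUnion_le))
  have hsum := sum_le_sum hpair
  rw [sum_const, card_univ, Fintype.card_prod, nsmul_eq_mul, Nat.cast_mul] at hsum
  rw [hPcard, Nat.cast_pow] at hcount
  linarith

end Tuples

section SubsetSum

variable {n : ℕ} {G : Type*}

/-- The sum of the entries of `g` selected by the point `x` of the cube. A mod-`p` form restricted
to the cube is the subset sum of its coefficients. -/
def subsetSum [AddCommMonoid G] (g : Fin n → G) (x : Cube n) : G :=
  ∑ z, if x z then g z else 0

theorem subsetSum_add [AddCommMonoid G] (g h : Fin n → G) (x : Cube n) :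
    subsetSum (g + h) x = subsetSum g x + subsetSum h x := by
  simp only [subsetSum, Pi.add_apply, ← sum_add_distrib]
  exact sum_congr rfl fun z _ => by split_ifs <;> simp

theorem subsetSum_smul {R : Type*} [Semiring R] (a : R) (g : Fin n → R) (x : Cube n) :
    subsetSum (a • g) x = a * subsetSum g x := by
  simp only [subsetSum, mul_sum, mul_ite, mul_zero, Pi.smul_apply, smul_eq_mul]

theorem subsetSum_sub [AddCommGroup G] (g h : Fin n → G) (x : Cube n) :
    subsetSum (g - h) x = subsetSum g x - subsetSum h x := by
  rw [eq_sub_iff_add_eq, ← subsetSum_add, sub_add_cancel]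

theorem apply_toZMod_eq_subsetSum {p : ℕ} (φ : ModPForm p n) (x : Cube n) :
    φ (x.toZMod p) = subsetSum (fun z => φ (Pi.single z 1)) x := by
  rw [LinearMap.pi_apply_eq_sum_univ φ (x.toZMod p)]
  refine sum_congr rfl fun z _ => ?_
  have hsingle : (fun j => if z = j then (1 : ZMod p) else 0) = Pi.single z 1 := by
    ext j
    simp only [Pi.single_apply, eq_comm]
  rw [hsingle, Cube.toZMod, ite_smul, one_smul, zero_smul]

theorem dependsOn_subsetSum [AddCommMonoid G] {g : Fin n → G} {S : Set (Fin n)}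
    (h : Function.support g ⊆ S) : DependsOn (subsetSum g) S := fun x y hxy => by
  refine sum_congr rfl fun z _ => ?_
  by_cases hz : g z = 0
  · simp only [hz, ite_self]
  · rw [hxy z (h hz)]

open Classical in
theorem exists_subsetSum_indicator_eq_sum [AddCommMonoid G] {ι : Type*} {I : Finset ι}
    {W : ι → Set (Fin n)} {Y : Set (Fin n)} (hW : (I : Set ι).PairwiseDisjoint W)
    (hY : ∀ i ∈ I, W i ⊆ Y) (g : Fin n → G) (x : ι → Cube n) :
    ∃ y, subsetSum (Y.indicator g) y = ∑ i ∈ I, subsetSum ((W i).indicator g) (x i) := by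
  refine ⟨fun z => decide (∃ i ∈ I, z ∈ W i ∧ x i z), ?_⟩
  simp only [subsetSum]
  rw [sum_comm]
  refine sum_congr rfl fun z _ => ?_
  by_cases hz : ∃ i ∈ I, z ∈ W i
  · obtain ⟨i, hi, hzi⟩ := hz
    have huniq : ∀ j ∈ I, z ∈ W j → j = i := fun j hj hzj =>
      hW.elim hj hi (Set.not_disjoint_iff.2 ⟨z, hzj, hzi⟩)
    have hx : (∃ j ∈ I, z ∈ W j ∧ x j z = true) ↔ x i z = true :=
      ⟨fun ⟨j, hj, hzj, hx⟩ => huniq j hj hzj ▸ hx, fun hx => ⟨i, hi, hzi, hx⟩⟩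
    have hother (j : ι) (hj : j ∈ I) (hji : j ≠ i) :
        (if x j z then (W j).indicator g z else 0) = 0 := by
      rw [Set.indicator_of_notMem fun hzj => hji (huniq j hj hzj), ite_self]
    rw [sum_eq_single_of_mem i hi hother]
    simp [hx, hzi, hY i hi hzi]
  · push Not at hz
    have hx : ¬ ∃ i ∈ I, z ∈ W i ∧ x i z = true := fun ⟨i, hi, hzi, _⟩ => hz i hi hzi
    rw [sum_eq_zero fun i hi => by rw [Set.indicator_of_notMem (hz i hi), ite_self]]
    simp [hx]

variable [AddCommGroup G]

theorem exists_nonempty_sum_eq_zero [Fintype G] (hn : Fintype.card G ≤ n) (g : Fin n → G) :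
    ∃ T : Finset (Fin n), T.Nonempty ∧ ∑ z ∈ T, g z = 0 := by
  let below (k : Fin (n + 1)) : Finset (Fin n) := {z : Fin n | (z : ℕ) < k}
  obtain ⟨i, j, hij, hsum⟩ : ∃ i j, i < j ∧ ∑ z ∈ below i, g z = ∑ z ∈ below j, g z := by
    obtain ⟨i, j, hne, hsum⟩ := Fintype.exists_ne_map_eq_of_card_lt
      (fun k => ∑ z ∈ below k, g z) (by rw [Fintype.card_fin]; omega)
    rcases hne.lt_or_gt with h | h
    exacts [⟨i, j, h, hsum⟩, ⟨j, i, h, hsum.symm⟩]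
  have hij' : (i : ℕ) < j := hij
  have hsub : below i ⊆ below j := monotone_filter_right _ fun z _ (hz : (z : ℕ) < i) =>
    hz.trans hij'
  refine ⟨below j \ below i, ⟨⟨i, by omega⟩, by simpa [below] using hij'⟩, ?_⟩
  rw [sum_sdiff_eq_sub hsub, hsum, sub_self]

theorem exists_ne_subsetSum_eq [Fintype G] (hn : Fintype.card G ≤ n) (g : Fin n → G)
    (y : Cube n) : ∃ y' ≠ y, subsetSum g y' = subsetSum g y := by
  obtain ⟨T, ⟨z₀, hz₀⟩, hT⟩ := exists_nonempty_sum_eq_zero hn fun z => if y z then -g z else g z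
  refine ⟨fun z => if z ∈ T then !y z else y z, fun h => ?_, ?_⟩
  · simpa [hz₀] using congrFun h z₀
  · rw [← sub_eq_zero, ← hT, subsetSum, subsetSum, ← sum_sub_distrib, ← univ_inter T,
      ← sum_ite_mem]
    refine sum_congr rfl fun z _ => ?_
    by_cases hz : z ∈ T <;> cases y z <;> simp [hz]

variable [DecidableEq G]

theorem card_fiber_succ (g : Fin (n + 1) → G) (z : Fin (n + 1)) (e : G) :
    #{x | subsetSum g x = e} =
      ∑ b : Bool, #{w | subsetSum (g ∘ z.succAbove) w = e - if b then g z else 0} := by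
  simp only [card_filter]
  rw [← (Fin.insertNthEquiv (fun _ => Bool) z).sum_comp, Fintype.sum_prod_type]
  refine sum_congr rfl fun b _ => sum_congr rfl fun w _ => ?_
  congr 1
  rw [subsetSum, Fin.sum_univ_succAbove _ z, eq_sub_iff_add_eq']
  simp [subsetSum]

/-- Since `card G` many coordinates admit a nontrivial exchange, some coordinate takes both values
on the fibre; splitting the fibre along it and inducting loses nothing. -/
theorem two_pow_le_card_fiber [Fintype G] (g : Fin n → G) (y : Cube n) :
    2 ^ n ≤ #{x | subsetSum g x = subsetSum g y} * 2 ^ (Fintype.card G - 1) := by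
  induction n with
  | zero =>
    rw [pow_zero, Nat.one_le_iff_ne_zero]
    have hpos : 0 < #{x | subsetSum g x = subsetSum g y} :=
      card_pos.2 ⟨y, mem_filter.2 ⟨mem_univ _, rfl⟩⟩
    positivity
  | succ k ih =>
    by_cases hk : k + 1 ≤ Fintype.card G - 1
    · have hpos : 0 < #{x | subsetSum g x = subsetSum g y} :=
        card_pos.2 ⟨y, mem_filter.2 ⟨mem_univ _, rfl⟩⟩
      exact (Nat.pow_le_pow_right two_pos hk).trans (Nat.le_mul_of_pos_left _ hpos)
    obtain ⟨y', hne, hy'⟩ := exists_ne_subsetSum_eq (by omega : Fintype.card G ≤ k + 1) g y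
    obtain ⟨z, hz⟩ := Function.ne_iff.1 hne
    have hhalf (b : Bool) : 2 ^ k ≤ #{w | subsetSum (g ∘ z.succAbove) w =
        subsetSum g y - if b then g z else 0} * 2 ^ (Fintype.card G - 1) := by
      obtain ⟨v, hv, hvb⟩ : ∃ v, subsetSum g v = subsetSum g y ∧ v z = b := by
        by_cases hb : y z = b
        · exact ⟨y, rfl, hb⟩
        · refine ⟨y', hy', ?_⟩
          revert hz hb
          cases y z <;> cases y' z <;> cases b <;> simp
      have hvz : subsetSum (g ∘ z.succAbove) (v ∘ z.succAbove) =
          subsetSum g y - if b then g z else 0 := by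
        rw [← hv, ← hvb, eq_sub_iff_add_eq', subsetSum, subsetSum, Fin.sum_univ_succAbove _ z]
        rfl
      rw [← hvz]
      exact ih (g ∘ z.succAbove) (v ∘ z.succAbove)
    rw [card_fiber_succ g z, sum_mul]
    calc 2 ^ (k + 1) = ∑ _b : Bool, 2 ^ k := by simp [pow_succ, mul_comm]
      _ ≤ _ := sum_le_sum fun b _ => hhalf b

end SubsetSum

section AlmostOrthogonal

variable {𝕜 ι : Type*} [RCLike 𝕜] {K : Finset ι} {κ : ℝ}

section InnerProductSpace

variable {E : Type*} [NormedAddCommGroup E] [InnerProductSpace 𝕜 E] {u : ι → E} {M : ℝ}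

theorem norm_sum_smul_sq_le (hκ : 0 ≤ κ) (hu : ∀ k ∈ K, ‖u k‖ ^ 2 ≤ M)
    (huu : ∀ k ∈ K, ∀ l ∈ K, k ≠ l → ‖inner 𝕜 (u k) (u l)‖ ≤ κ) (c : ι → 𝕜) :
    ‖∑ k ∈ K, c k • u k‖ ^ 2 ≤ (M + κ * #K) * ∑ k ∈ K, ‖c k‖ ^ 2 := by
  classical
  have hterm : ∀ k ∈ K, ∀ l ∈ K, ‖inner 𝕜 (c k • u k) (c l • u l)‖ ≤
      (if k = l then ‖c k‖ ^ 2 * M else 0) + ‖c k‖ * ‖c l‖ * κ := by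
    intro k hk l hl
    rw [inner_smul_left, inner_smul_right, norm_mul, norm_mul, RCLike.norm_conj, ← mul_assoc]
    split_ifs with hkl
    · subst hkl
      have hnorm : ‖inner 𝕜 (u k) (u k)‖ ≤ M := by
        rw [inner_self_eq_norm_sq_to_K]
        simpa using hu k hk
      rw [← sq]
      exact le_add_of_le_of_nonneg (by gcongr) (by positivity)
    · rw [zero_add]
      gcongr
      exact huu k hk l hl hkl
  calc ‖∑ k ∈ K, c k • u k‖ ^ 2
      = ‖inner 𝕜 (∑ k ∈ K, c k • u k) (∑ l ∈ K, c l • u l)‖ := by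
        rw [inner_self_eq_norm_sq_to_K]; simp
    _ ≤ ∑ k ∈ K, ∑ l ∈ K, ‖inner 𝕜 (c k • u k) (c l • u l)‖ := by
        rw [sum_inner]
        refine (norm_sum_le _ _).trans (sum_le_sum fun k _ => ?_)
        rw [inner_sum]
        exact norm_sum_le _ _
    _ ≤ ∑ k ∈ K, ∑ l ∈ K, ((if k = l then ‖c k‖ ^ 2 * M else 0) + ‖c k‖ * ‖c l‖ * κ) :=
        sum_le_sum fun k hk => sum_le_sum fun l hl => hterm k hk l hl
    _ = M * ∑ k ∈ K, ‖c k‖ ^ 2 + κ * (∑ k ∈ K, ‖c k‖) ^ 2 := by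
        simp only [sum_add_distrib, sum_ite_eq, ← sum_mul, sq (∑ k ∈ K, ‖c k‖), sum_mul_sum]
        rw [mul_sum, sum_congr rfl fun k hk => if_pos hk]
        simp only [mul_comm]
    _ ≤ M * ∑ k ∈ K, ‖c k‖ ^ 2 + κ * (#K * ∑ k ∈ K, ‖c k‖ ^ 2) := by
        gcongr; exact sq_sum_le_card_mul_sum_sq
    _ = (M + κ * #K) * ∑ k ∈ K, ‖c k‖ ^ 2 := by ring

/-- By duality: test `w` against the vector `∑ ⟪u k, w⟫ • u k`. -/
theorem sum_norm_inner_sq_le (hM : 0 ≤ M) (hκ : 0 ≤ κ) (hu : ∀ k ∈ K, ‖u k‖ ^ 2 ≤ M)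
    (huu : ∀ k ∈ K, ∀ l ∈ K, k ≠ l → ‖inner 𝕜 (u k) (u l)‖ ≤ κ) (w : E) :
    ∑ k ∈ K, ‖inner 𝕜 (u k) w‖ ^ 2 ≤ (M + κ * #K) * ‖w‖ ^ 2 := by
  set v := ∑ k ∈ K, inner 𝕜 (u k) w • u k with hv
  set S := ∑ k ∈ K, ‖inner 𝕜 (u k) w‖ ^ 2 with hS
  have hvw : inner 𝕜 v w = (S : 𝕜) := by
    simp only [hv, sum_inner, inner_smul_left, hS]
    push_cast
    exact sum_congr rfl fun k _ => RCLike.conj_mul _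
  have hS_nonneg : 0 ≤ S := by positivity
  have hS_le : S ≤ ‖v‖ * ‖w‖ := by
    calc S = ‖inner 𝕜 v w‖ := by rw [hvw, RCLike.norm_ofReal, abs_of_nonneg hS_nonneg]
      _ ≤ ‖v‖ * ‖w‖ := norm_inner_le_norm v w
  rcases hS_nonneg.eq_or_lt with hS_zero | hS_pos
  · rw [← hS_zero]; positivity
  refine le_of_mul_le_mul_left ?_ hS_pos
  calc S * S ≤ (‖v‖ * ‖w‖) * (‖v‖ * ‖w‖) := by gcongr
    _ = ‖v‖ ^ 2 * ‖w‖ ^ 2 := by ring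
    _ ≤ (M + κ * #K) * S * ‖w‖ ^ 2 := by gcongr; exact norm_sum_smul_sq_le hκ hu huu _
    _ = S * ((M + κ * #K) * ‖w‖ ^ 2) := by ring

end InnerProductSpace

variable {X : Type*} [Fintype X] {u : ι → X → 𝕜}

theorem sum_norm_sum_sq_le (hκ : 0 ≤ κ) (hu : ∀ k ∈ K, ∀ x, ‖u k x‖ ≤ 1)
    (huu : ∀ k ∈ K, ∀ l ∈ K, k ≠ l → ‖𝔼 x, u k x * conj (u l x)‖ ≤ κ) (A : Finset X) :
    ∑ k ∈ K, ‖∑ x ∈ A, u k x‖ ^ 2 ≤ Fintype.card X * (1 + κ * #K) * #A := by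
  classical
  set U : ι → EuclideanSpace 𝕜 X := fun k => WithLp.toLp 2 (u k) with hU
  set w : EuclideanSpace 𝕜 X := WithLp.toLp 2 fun x => if x ∈ A then 1 else 0 with hw
  have hUnorm : ∀ k ∈ K, ‖U k‖ ^ 2 ≤ Fintype.card X := fun k hk => by
    rw [EuclideanSpace.norm_sq_eq]
    calc ∑ x, ‖u k x‖ ^ 2 ≤ ∑ _x : X, (1 : ℝ) :=
          sum_le_sum fun x _ => pow_le_one₀ (norm_nonneg _) (hu k hk x)
      _ = Fintype.card X := by simp
  have hUU : ∀ k ∈ K, ∀ l ∈ K, k ≠ l → ‖inner 𝕜 (U k) (U l)‖ ≤ Fintype.card X * κ := by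
    intro k hk l hl hkl
    calc ‖inner 𝕜 (U k) (U l)‖ = ‖∑ x, u l x * conj (u k x)‖ := by simp [hU, PiLp.inner_apply]
      _ = Fintype.card X * ‖𝔼 x, u l x * conj (u k x)‖ := by
        rw [← Fintype.card_smul_expect, nsmul_eq_mul, norm_mul, RCLike.norm_natCast]
      _ ≤ Fintype.card X * κ := by gcongr; exact huu l hl k hk hkl.symm
  have hUw : ∀ k, ‖inner 𝕜 (U k) w‖ = ‖∑ x ∈ A, u k x‖ := fun k => by
    rw [← RCLike.norm_conj, inner_conj_symm]
    simp [hU, hw, PiLp.inner_apply]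
  have hwnorm : ‖w‖ ^ 2 = #A := by
    rw [EuclideanSpace.norm_sq_eq]
    simp [hw, apply_ite]
  calc ∑ k ∈ K, ‖∑ x ∈ A, u k x‖ ^ 2 = ∑ k ∈ K, ‖inner 𝕜 (U k) w‖ ^ 2 := by simp only [hUw]
    _ ≤ (Fintype.card X + Fintype.card X * κ * #K) * ‖w‖ ^ 2 :=
      sum_norm_inner_sq_le (by positivity) (by positivity) hUnorm hUU w
    _ = Fintype.card X * (1 + κ * #K) * #A := by rw [hwnorm]; ring

theorem card_mul_le_one_of_le_norm_expect {A : Finset X} {δ η : ℝ} (hη : 0 ≤ η) (hκ : 0 ≤ κ)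
    (hA : A.Nonempty) (hδA : δ * Fintype.card X ≤ #A) (hu : ∀ k ∈ K, ∀ x, ‖u k x‖ ≤ 1)
    (huA : ∀ k ∈ K, η ≤ ‖𝔼 x ∈ A, u k x‖)
    (huu : ∀ k ∈ K, ∀ l ∈ K, k ≠ l → ‖𝔼 x, u k x * conj (u l x)‖ ≤ κ) :
    #K * (δ * η ^ 2 - κ) ≤ 1 := by
  have hApos : (0 : ℝ) < #A := by exact_mod_cast hA.card_pos
  have hXpos : (0 : ℝ) < Fintype.card X := by exact_mod_cast Fintype.card_pos_iff.2 ⟨hA.choose⟩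
  have hlower : #K * (#A * η) ^ 2 ≤ ∑ k ∈ K, ‖∑ x ∈ A, u k x‖ ^ 2 := by
    rw [← nsmul_eq_mul, ← sum_const]
    refine sum_le_sum fun k hk => ?_
    rw [← card_smul_expect, nsmul_eq_mul, norm_mul, RCLike.norm_natCast]
    gcongr
    exact huA k hk
  have hdiv : #K * η ^ 2 * #A ≤ Fintype.card X * (1 + κ * #K) :=
    le_of_mul_le_mul_right (by linarith [sum_norm_sum_sq_le hκ hu huu A]) hApos
  refine le_of_mul_le_mul_right ?_ hXpos
  calc #K * (δ * η ^ 2 - κ) * Fintype.card X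
      = #K * η ^ 2 * (δ * Fintype.card X) - #K * κ * Fintype.card X := by ring
    _ ≤ #K * η ^ 2 * #A - #K * κ * Fintype.card X := by gcongr
    _ ≤ 1 * Fintype.card X := by linarith

end AlmostOrthogonal

section Characters

variable {n p : ℕ}

theorem expect_prod_apply {𝕜 : Type*} [Field 𝕜] [CharZero 𝕜] (g : Fin n → Bool → 𝕜) :
    𝔼 x : Cube n, ∏ z, g z (x z) = ∏ z, 𝔼 b, g z b := by
  simp only [Fintype.expect_eq_sum_div_card, prod_div_distrib, prod_univ_sum,
    Fintype.piFinset_univ]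
  simp

/-- The Walsh function of the coordinates in `T`. -/
noncomputable def walsh (T : Finset (Fin n)) (x : Cube n) : ℂ :=
  ∏ z ∈ T, if x z then -1 else 1

@[simp]
theorem walsh_empty (x : Cube n) : walsh ∅ x = 1 := prod_empty

theorem walsh_eq_prod_univ (T : Finset (Fin n)) (x : Cube n) :
    walsh T x = ∏ z, if z ∈ T ∧ x z then -1 else 1 := by
  simp only [walsh, ite_and, prod_ite_mem, univ_inter]

theorem walsh_union {T U : Finset (Fin n)} (h : Disjoint T U) (x : Cube n) :
    walsh (T ∪ U) x = walsh T x * walsh U x :=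
  prod_union h

theorem walsh_mul_walsh (T U : Finset (Fin n)) (x : Cube n) :
    walsh T x * walsh U x = walsh (T ∆ U) x := by
  simp only [walsh_eq_prod_univ, ← prod_mul_distrib]
  refine prod_congr rfl fun z _ => ?_
  by_cases hT : z ∈ T <;> by_cases hU : z ∈ U <;> cases x z <;> simp [hT, hU, mem_symmDiff]

theorem norm_walsh (T : Finset (Fin n)) (x : Cube n) : ‖walsh T x‖ = 1 := by
  rw [walsh, norm_prod]
  exact prod_eq_one fun z _ => by split_ifs <;> simp

theorem conj_walsh (T : Finset (Fin n)) (x : Cube n) : conj (walsh T x) = walsh T x := by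
  rw [walsh, map_prod]
  exact prod_congr rfl fun z _ => by split_ifs <;> simp

variable [NeZero p]

theorem stdAddChar_subsetSum (φ : Fin n → ZMod p) (x : Cube n) :
    stdAddChar (subsetSum φ x) = ∏ z, if x z then stdAddChar (φ z) else 1 := by
  refine (map_prod stdAddChar.toMonoidHom (fun z => Multiplicative.ofAdd (if x z then φ z else 0))
    univ).trans ?_
  exact prod_congr rfl fun z _ => by split_ifs <;> simp

/-- The character of the cube attached to the mod-`p` form with coefficients `φ`, twisted by the
Walsh function of `T`. -/
noncomputable def twistedChar (φ : Fin n → ZMod p) (T : Finset (Fin n)) (x : Cube n) : ℂ :=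
  stdAddChar (subsetSum φ x) * walsh T x

theorem norm_twistedChar (φ : Fin n → ZMod p) (T : Finset (Fin n)) (x : Cube n) :
    ‖twistedChar φ T x‖ = 1 := by
  rw [twistedChar, norm_mul, AddChar.norm_apply, norm_walsh, one_mul]

theorem twistedChar_mul_conj (φ ψ : Fin n → ZMod p) (T U : Finset (Fin n)) (x : Cube n) :
    twistedChar φ T x * conj (twistedChar ψ U x) = twistedChar (φ - ψ) (T ∆ U) x := by
  rw [twistedChar, twistedChar, twistedChar, map_mul, conj_walsh, mul_mul_mul_comm,
    walsh_mul_walsh, ← AddChar.map_neg_eq_conj, ← AddChar.map_add_eq_mul, ← sub_eq_add_neg,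
    subsetSum_sub]

/-- The Fourier coefficient of the uniform distribution on `A` at the form with coefficients `φ`,
twisted by the Walsh function of `T`. -/
noncomputable def coeff (A : Finset (Cube n)) (φ : Fin n → ZMod p) (T : Finset (Fin n)) : ℂ :=
  𝔼 x ∈ A, twistedChar φ T x

theorem coeff_univ (φ : Fin n → ZMod p) (T : Finset (Fin n)) :
    coeff univ φ T = ∏ z, (1 + if z ∈ T then -stdAddChar (φ z) else stdAddChar (φ z)) / 2 := by
  have hprod (x : Cube n) : twistedChar φ T x =
      ∏ z, if x z then if z ∈ T then -stdAddChar (φ z) else stdAddChar (φ z) else 1 := by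
    rw [twistedChar, stdAddChar_subsetSum, walsh_eq_prod_univ, ← prod_mul_distrib]
    exact prod_congr rfl fun z _ => by cases x z <;> by_cases hz : z ∈ T <;> simp [hz]
  rw [coeff, expect_congr rfl fun x _ => hprod x, expect_prod_apply fun z b =>
    if b then if z ∈ T then -stdAddChar (φ z) else stdAddChar (φ z) else 1]
  refine prod_congr rfl fun z _ => ?_
  rw [Fintype.expect_eq_sum_div_card, Fintype.sum_bool, Fintype.card_bool]
  simp [add_comm]

theorem coeff_univ_zero {T : Finset (Fin n)} (hT : T.Nonempty) :
    coeff univ (0 : Fin n → ZMod p) T = 0 := by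
  obtain ⟨z, hz⟩ := hT
  rw [coeff_univ]
  exact prod_eq_zero (mem_univ z) (by simp [hz])

theorem norm_one_add_stdAddChar_lt {a : ZMod p} (ha : a ≠ 0) : ‖1 + stdAddChar a‖ < 2 := by
  have hne : (1 : ℂ) ≠ stdAddChar a := fun h =>
    ha (injective_stdAddChar (h.symm.trans (AddChar.map_zero_eq_one _).symm))
  have hray : ¬ SameRay ℝ 1 (stdAddChar a) := by
    rwa [sameRay_iff_of_norm_eq (by rw [AddChar.norm_apply, norm_one])]
  have hlt := not_sameRay_iff_norm_add_lt.1 hray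
  rwa [AddChar.norm_apply, norm_one, one_add_one_eq_two] at hlt

theorem exists_norm_coeff_univ_le_pow (p : ℕ) [NeZero p] : ∃ γ : ℝ, 0 ≤ γ ∧ γ < 1 ∧
    ∀ ⦃n⦄ (φ : Fin n → ZMod p), ‖coeff univ φ ∅‖ ≤ γ ^ hammingNorm φ := by
  obtain ⟨b, hb⟩ := Finite.exists_max
    fun a : ZMod p => if a = 0 then 0 else ‖1 + stdAddChar a‖ / 2
  set γ := if b = 0 then 0 else ‖1 + stdAddChar b‖ / 2 with hγ
  refine ⟨γ, by rw [hγ]; split_ifs <;> positivity, ?_, fun n φ => ?_⟩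
  · rw [hγ]
    split_ifs with h
    · exact one_pos
    · linarith [norm_one_add_stdAddChar_lt h]
  · rw [coeff_univ, norm_prod, hammingNorm, ← prod_const, prod_filter]
    refine prod_le_prod (fun _ _ => norm_nonneg _) fun z _ => ?_
    by_cases h : φ z = 0
    · simp [h, one_add_one_eq_two]
    · simpa [h] using hb (φ z)

/-- Forms with at least `r` non-zero coefficients have bias at most `κ` on the whole cube, in any
number of variables. -/
def IsDecayRadius (p r : ℕ) [NeZero p] (κ : ℝ) : Prop :=
  ∀ ⦃n⦄ (φ : Fin n → ZMod p), r ≤ hammingNorm φ → ‖coeff univ φ ∅‖ ≤ κ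

theorem exists_isDecayRadius (p : ℕ) [NeZero p] {κ : ℝ} (hκ : 0 < κ) :
    ∃ r, IsDecayRadius p r κ := by
  obtain ⟨γ, hγ₀, hγ₁, hγ⟩ := exists_norm_coeff_univ_le_pow p
  obtain ⟨r, hr⟩ := exists_pow_lt_of_lt_one hκ hγ₁
  exact ⟨r, fun n φ hφ => (hγ φ).trans ((pow_le_pow_of_le_one hγ₀ hγ₁.le hφ).trans hr.le)⟩

end Characters

section LargeCoefficients

variable {n p r : ℕ} [NeZero p] {δ η : ℝ} {A : Finset (Cube n)}

theorem nonempty_of_le_density (hδ : 0 < δ) (hA : δ ≤ density A) : A.Nonempty := by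
  by_contra h
  rw [not_nonempty_iff_eq_empty] at h
  rw [h, density, card_empty, Nat.cast_zero, zero_div] at hA
  exact hA.not_gt hδ

theorem mul_card_cube_le_of_le_density (hA : δ ≤ density A) :
    δ * Fintype.card (Cube n) ≤ #A := by
  rw [density, le_div_iff₀ (by positivity)] at hA
  simpa using hA

theorem card_le_of_le_norm_coeff_of_le_hammingDist (hδ : 0 < δ) (hη : 0 < η)
    (hr : IsDecayRadius p r (δ * η ^ 2 / 2)) (hA : δ ≤ density A) {K : Finset (Fin n → ZMod p)}
    (hK : ∀ φ ∈ K, η ≤ ‖coeff A φ ∅‖)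
    (hsep : (K : Set (Fin n → ZMod p)).Pairwise fun φ ψ => r ≤ hammingDist φ ψ) :
    #K ≤ ⌊2 / (δ * η ^ 2)⌋₊ := by
  have h : #K * (δ * η ^ 2 - δ * η ^ 2 / 2) ≤ 1 :=
    card_mul_le_one_of_le_norm_expect (u := fun φ => twistedChar φ ∅) hη.le (by positivity)
      (nonempty_of_le_density hδ hA) (mul_card_cube_le_of_le_density hA)
      (fun φ _ x => (norm_twistedChar φ ∅ x).le) hK fun φ hφ ψ hψ hne => by
        simp only [twistedChar_mul_conj]
        rw [symmDiff_self]
        refine hr _ ((hsep hφ hψ hne).trans_eq ?_)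
        rw [hammingDist_comm, hammingDist_eq_hammingNorm, neg_add_eq_sub]
  exact Nat.le_floor ((le_div_iff₀ (by positivity)).2 (by linarith))

theorem card_le_of_le_norm_coeff_walsh (hδ : 0 < δ) (hη : 0 < η) (hA : δ ≤ density A)
    (φ : Fin n → ZMod p) {K : Finset (Finset (Fin n))} (hK : ∀ T ∈ K, η ≤ ‖coeff A φ T‖) :
    #K ≤ ⌊1 / (δ * η ^ 2)⌋₊ := by
  have h : #K * (δ * η ^ 2 - 0) ≤ 1 :=
    card_mul_le_one_of_le_norm_expect (u := twistedChar φ) hη.le le_rfl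
      (nonempty_of_le_density hδ hA) (mul_card_cube_le_of_le_density hA)
      (fun T _ x => (norm_twistedChar φ T x).le) hK fun T _ U _ hne => by
        simp only [twistedChar_mul_conj]
        rw [sub_self]
        exact (norm_eq_zero.2 (coeff_univ_zero (symmDiff_nonempty.2 hne))).le
  exact Nat.le_floor ((le_div_iff₀ (by positivity)).2 (by linarith))

end LargeCoefficients

section Independence

variable {n p : ℕ} {S S' : Finset (Fin n)}

/-- The Walsh coefficient of `f` at the coordinate set `T`. -/
noncomputable def walshCoeff (f : Cube n → ℂ) (T : Finset (Fin n)) : ℂ :=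
  𝔼 x, f x * walsh T x

theorem norm_walshCoeff_le {f : Cube n → ℂ} (hf : ∀ x, ‖f x‖ ≤ 1) (T : Finset (Fin n)) :
    ‖walshCoeff f T‖ ≤ 1 :=
  (RCLike.norm_expect_le (K := ℂ)).trans <| expect_le univ_nonempty fun x _ => by
    rw [norm_mul, norm_walsh, mul_one]
    exact hf x

theorem expect_walsh {T : Finset (Fin n)} (hT : T.Nonempty) : 𝔼 x, walsh T x = 0 := by
  simpa [coeff, twistedChar, subsetSum] using coeff_univ_zero (p := 1) hT

theorem eq_of_sum_walsh_mul_walsh_ne_zero {x y : Cube n}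
    (h : ∑ T ∈ S.powerset, walsh T x * walsh T y ≠ 0) : ∀ z ∈ S, x z = y z := by
  simp only [walsh, ← prod_mul_distrib] at h
  rw [← prod_one_add] at h
  intro z hz
  have hne := prod_ne_zero_iff.1 h z hz
  cases hx : x z <;> cases hy : y z <;> simp [hx, hy] at hne ⊢

theorem eq_sum_walshCoeff_of_dependsOn {f : Cube n → ℂ} (hf : DependsOn f S) (x : Cube n) :
    f x = ∑ T ∈ S.powerset, walshCoeff f T * walsh T x := by
  have hkernel (y : Cube n) : f y * ∑ T ∈ S.powerset, walsh T x * walsh T y =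
      f x * ∑ T ∈ S.powerset, walsh T x * walsh T y := by
    by_cases h : ∑ T ∈ S.powerset, walsh T x * walsh T y = 0
    · rw [h, mul_zero, mul_zero]
    · rw [hf fun z hz => eq_of_sum_walsh_mul_walsh_ne_zero h z hz]
  have hmean : 𝔼 y, ∑ T ∈ S.powerset, walsh T x * walsh T y = 1 := by
    rw [expect_sum_comm, sum_eq_single_of_mem ∅ (empty_mem_powerset S)]
    · simp
    · intro T _ hT
      rw [← mul_expect, expect_walsh (nonempty_iff_ne_empty.2 hT), mul_zero]
  calc f x = 𝔼 y, f x * ∑ T ∈ S.powerset, walsh T x * walsh T y := by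
        rw [← mul_expect, hmean, mul_one]
    _ = 𝔼 y, ∑ T ∈ S.powerset, f y * walsh T y * walsh T x :=
        expect_congr rfl fun y _ => by
          rw [← hkernel, mul_sum]
          exact sum_congr rfl fun T _ => by ring
    _ = ∑ T ∈ S.powerset, walshCoeff f T * walsh T x := by
        rw [expect_sum_comm]
        simp only [walshCoeff, expect_mul]

variable [NeZero p] {A : Finset (Cube n)} {φ : Fin n → ZMod p} {g h : Cube n → ℂ}

theorem expect_mul_mul_eq_sum_coeff (hSS' : Disjoint S S') (hg : DependsOn g S)
    (hh : DependsOn h S') :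
    𝔼 x ∈ A, stdAddChar (subsetSum φ x) * g x * h x = ∑ T ∈ S.powerset, ∑ U ∈ S'.powerset,
      walshCoeff g T * walshCoeff h U * coeff A φ (T ∪ U) := by
  simp only [coeff, mul_expect, ← expect_sum_comm]
  refine expect_congr rfl fun x _ => ?_
  rw [eq_sum_walshCoeff_of_dependsOn hg x, eq_sum_walshCoeff_of_dependsOn hh x, mul_assoc,
    sum_mul_sum, mul_sum]
  refine sum_congr rfl fun T hT => ?_
  rw [mul_sum]
  refine sum_congr rfl fun U hU => ?_
  rw [twistedChar, walsh_union (hSS'.mono (mem_powerset.1 hT) (mem_powerset.1 hU))]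
  ring

theorem norm_expect_mul_mul_le {θ : ℝ} (hSS' : Disjoint S S') (hθ₀ : 0 ≤ θ)
    (hθ : ∀ T ⊆ S ∪ S', ¬ T ⊆ S → ‖coeff A φ T‖ ≤ θ) (hgS : DependsOn g S)
    (hhS : DependsOn h S') (hg : ∀ x, ‖g x‖ ≤ 1) (hh : ∀ x, ‖h x‖ ≤ 1) (hmean : 𝔼 x, h x = 0) :
    ‖𝔼 x ∈ A, stdAddChar (subsetSum φ x) * g x * h x‖ ≤ 2 ^ (#S + #S') * θ := by
  have hterm : ∀ T ∈ S.powerset, ∀ U ∈ S'.powerset,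
      ‖walshCoeff g T * walshCoeff h U * coeff A φ (T ∪ U)‖ ≤ θ := by
    intro T hT U hU
    rw [mem_powerset] at hT hU
    rcases U.eq_empty_or_nonempty with rfl | ⟨z, hz⟩
    · simpa [walshCoeff, hmean] using hθ₀
    · have hTU : ¬ T ∪ U ⊆ S := fun hsub =>
        disjoint_left.1 hSS' (hsub (mem_union_right T hz)) (hU hz)
      rw [norm_mul, norm_mul]
      exact (mul_le_of_le_one_left (norm_nonneg _) (mul_le_one₀ (norm_walshCoeff_le hg T)
        (norm_nonneg _) (norm_walshCoeff_le hh U))).trans (hθ _ (union_subset_union hT hU) hTU)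
  calc ‖𝔼 x ∈ A, stdAddChar (subsetSum φ x) * g x * h x‖
      ≤ ∑ T ∈ S.powerset, ∑ U ∈ S'.powerset,
          ‖walshCoeff g T * walshCoeff h U * coeff A φ (T ∪ U)‖ := by
        rw [expect_mul_mul_eq_sum_coeff hSS' hgS hhS]
        exact (norm_sum_le _ _).trans (sum_le_sum fun T _ => norm_sum_le _ _)
    _ ≤ ∑ _T ∈ S.powerset, ∑ _U ∈ S'.powerset, θ :=
        sum_le_sum fun T hT => sum_le_sum fun U hU => hterm T hT U hU
    _ = 2 ^ (#S + #S') * θ := by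
        simp only [sum_const, card_powerset, nsmul_eq_mul]
        push_cast
        ring

end Independence

section Distribution

variable {n : ℕ} {A : Finset (Cube n)} {D E : Type*} [DecidableEq D] [DecidableEq E]

theorem distr_nonneg (A : Finset (Cube n)) (F : Cube n → D) (d : D) : 0 ≤ distr A F d := by
  unfold distr
  positivity

theorem distr_le_one (A : Finset (Cube n)) (F : Cube n → D) (d : D) : distr A F d ≤ 1 :=
  div_le_one_of_le₀ (by exact_mod_cast card_filter_le A fun x => F x = d) (by positivity)

theorem distr_le_distr {F : Cube n → D} {G : Cube n → E} {d : D} {e : E}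
    (h : ∀ x, F x = d → G x = e) : distr A F d ≤ distr A G e := by
  unfold distr
  gcongr
  exact h _

theorem ofReal_distr (A : Finset (Cube n)) (F : Cube n → D) (d : D) :
    (distr A F d : ℂ) = 𝔼 x ∈ A, if F x = d then 1 else 0 := by
  rw [expect_eq_sum_div_card, sum_boole, distr]
  push_cast
  rfl

variable {p : ℕ} [NeZero p]

theorem ite_eq_expect_stdAddChar (a b : ZMod p) :
    (if a = b then 1 else 0) = 𝔼 c : ZMod p, stdAddChar (c * (a - b)) := by
  have hp : (p : ℂ) ≠ 0 := NeZero.ne _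
  rw [Fintype.expect_eq_sum_div_card, AddChar.sum_mulShift _ (isPrimitive_stdAddChar p),
    ZMod.card]
  simp only [sub_eq_zero]
  split_ifs <;> simp [hp]

theorem ofReal_distr_subsetSum (A : Finset (Cube n)) (φ : Fin n → ZMod p) (d : ZMod p) :
    (distr A (subsetSum φ) d : ℂ) = 𝔼 c : ZMod p, coeff A (c • φ) ∅ * stdAddChar (-(c * d)) := by
  simp only [ofReal_distr, ite_eq_expect_stdAddChar, coeff, expect_mul]
  rw [expect_comm]
  refine expect_congr rfl fun c _ => expect_congr rfl fun x _ => ?_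
  rw [twistedChar, walsh_empty, mul_one, subsetSum_smul, mul_sub, sub_eq_add_neg,
    AddChar.map_add_eq_mul]

theorem abs_distr_subsetSum_sub_inv_le {η : ℝ} {φ : Fin n → ZMod p} (hA : A.Nonempty)
    (hη : 0 ≤ η) (hφ : ∀ c : ZMod p, c ≠ 0 → ‖coeff A (c • φ) ∅‖ ≤ η) (d : ZMod p) :
    |distr A (subsetSum φ) d - (p : ℝ)⁻¹| ≤ η := by
  have hinv : (p : ℂ)⁻¹ = 𝔼 c : ZMod p, if c = 0 then 1 else 0 := by
    rw [Fintype.expect_eq_sum_div_card, sum_ite_eq', if_pos (mem_univ _), ZMod.card, one_div]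
  rw [← Real.norm_eq_abs, ← Complex.norm_real, Complex.ofReal_sub, Complex.ofReal_inv,
    Complex.ofReal_natCast, ofReal_distr_subsetSum, hinv, ← expect_sub_distrib]
  refine (RCLike.norm_expect_le (K := ℂ)).trans (expect_le univ_nonempty fun c _ => ?_)
  by_cases hc : c = 0
  · have hcoeff : coeff A (0 : Fin n → ZMod p) ∅ = 1 := by
      simp [coeff, twistedChar, subsetSum, expect_const hA]
    simpa [hc, hcoeff] using hη
  · rw [if_neg hc, sub_zero, norm_mul, AddChar.norm_apply, mul_one]
    exact hφ c hc

theorem expect_stdAddChar_subsetSum_mul (ω : Fin n → ZMod p) (x : Cube n) (a d : ZMod p)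
    (g h : ℂ) :
    𝔼 b : ZMod p, stdAddChar (subsetSum (b • ω) x) * (stdAddChar (b * (a - d)) * g) * h =
      (if subsetSum ω x + a = d then 1 else 0) * (g * h) := by
  rw [ite_eq_expect_stdAddChar, expect_mul]
  refine expect_congr rfl fun b _ => ?_
  rw [subsetSum_smul, add_sub_assoc, mul_add, AddChar.map_add_eq_mul]
  ring

theorem norm_ite_sub_ofReal_le_one {P : Prop} [Decidable P] {u : ℝ} (hu₀ : 0 ≤ u)
    (hu₁ : u ≤ 1) : ‖(if P then 1 else 0) - (u : ℂ)‖ ≤ 1 := by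
  split_ifs
  · rw [← Complex.ofReal_one, ← Complex.ofReal_sub, Complex.norm_real, Real.norm_eq_abs, abs_le]
    constructor <;> linarith
  · rwa [zero_sub, norm_neg, Complex.norm_real, Real.norm_of_nonneg hu₀]

theorem abs_distr_prod_sub_mul_distr_le {S S' : Finset (Fin n)} (hSS' : Disjoint S S') {θ : ℝ}
    (hθ₀ : 0 ≤ θ) {ω : Fin n → ZMod p}
    (hθ : ∀ b : ZMod p, ∀ T ⊆ S ∪ S', ¬ T ⊆ S → ‖coeff A (b • ω) T‖ ≤ θ) {ξ : Cube n → ZMod p}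
    {G : Cube n → D} {H : Cube n → E} (hξ : DependsOn ξ S) (hG : DependsOn G S)
    (hH : DependsOn H S') (d : ZMod p) (c : D) (e : E) :
    |distr A (fun x => ((subsetSum ω x + ξ x, G x), H x)) ((d, c), e) -
      distr A (fun x => (subsetSum ω x + ξ x, G x)) (d, c) * distr univ H e| ≤
      2 ^ (#S + #S') * θ := by
  set g : ZMod p → Cube n → ℂ :=
    fun b x => stdAddChar (b * (ξ x - d)) * if G x = c then 1 else 0 with hg
  set h : Cube n → ℂ := fun x => (if H x = e then 1 else 0) - distr univ H e with hh
  have hh_mean : 𝔼 x, h x = 0 := by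
    rw [hh, expect_sub_distrib, ← ofReal_distr, Fintype.expect_const, sub_self]
  have hexpand (x : Cube n) : 𝔼 b : ZMod p, stdAddChar (subsetSum (b • ω) x) * g b x * h x =
      (if ((subsetSum ω x + ξ x, G x), H x) = ((d, c), e) then 1 else 0) -
        (if (subsetSum ω x + ξ x, G x) = (d, c) then 1 else 0) * distr univ H e := by
    rw [hg, hh, expect_stdAddChar_subsetSum_mul]
    simp only [Prod.mk.injEq]
    split_ifs <;> simp_all
  rw [← Real.norm_eq_abs, ← Complex.norm_real]
  push_cast
  rw [ofReal_distr A, ofReal_distr A, expect_mul, ← expect_sub_distrib,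
    ← expect_congr rfl fun x _ => hexpand x, expect_comm]
  refine (RCLike.norm_expect_le (K := ℂ)).trans (expect_le univ_nonempty fun b _ => ?_)
  refine norm_expect_mul_mul_le hSS' hθ₀ (hθ b) (fun x y hxy => ?_) (fun x y hxy => ?_)
    (fun x => ?_)
    (fun x => norm_ite_sub_ofReal_le_one (distr_nonneg _ _ _) (distr_le_one _ _ _)) hh_mean
  · rw [hg]
    simp only [hξ hxy, hG hxy]
  · rw [hh]
    simp only [hH hxy]
  · rw [hg, norm_mul, AddChar.norm_apply]
    split_ifs <;> simp

end Distribution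

section ProjectiveDistance

variable {n p : ℕ}

/-- The Hamming distance between `φ` and `ψ` up to scaling by units. -/
noncomputable def projDist (φ ψ : Fin n → ZMod p) : ℕ :=
  ⨅ a : (ZMod p)ˣ, hammingDist φ (a • ψ)

theorem projDist_le (φ ψ : Fin n → ZMod p) (a : (ZMod p)ˣ) :
    projDist φ ψ ≤ hammingDist φ (a • ψ) :=
  ciInf_le (OrderBot.bddBelow _) a

theorem projDist_le_hammingDist (φ ψ : Fin n → ZMod p) : projDist φ ψ ≤ hammingDist φ ψ := by
  simpa using projDist_le φ ψ 1

theorem projDist_self (φ : Fin n → ZMod p) : projDist φ φ = 0 :=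
  Nat.le_zero.1 ((projDist_le_hammingDist φ φ).trans_eq (hammingDist_self φ))

theorem exists_hammingDist_eq_projDist (φ ψ : Fin n → ZMod p) :
    ∃ a : (ZMod p)ˣ, hammingDist φ (a • ψ) = projDist φ ψ :=
  ciInf_mem fun a : (ZMod p)ˣ => hammingDist φ (a • ψ)

theorem hammingDist_units_smul (a : (ZMod p)ˣ) (φ ψ : Fin n → ZMod p) :
    hammingDist (a • φ) (a • ψ) = hammingDist φ ψ :=
  hammingDist_smul fun _ => MulAction.injective a

theorem projDist_comm (φ ψ : Fin n → ZMod p) : projDist φ ψ = projDist ψ φ := by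
  have hle (φ ψ : Fin n → ZMod p) : projDist φ ψ ≤ projDist ψ φ := by
    obtain ⟨a, ha⟩ := exists_hammingDist_eq_projDist ψ φ
    rw [← ha, ← hammingDist_units_smul a⁻¹, inv_smul_smul, hammingDist_comm]
    exact projDist_le φ ψ a⁻¹
  exact (hle φ ψ).antisymm (hle ψ φ)

theorem projDist_triangle (φ ψ χ : Fin n → ZMod p) :
    projDist φ χ ≤ projDist φ ψ + projDist ψ χ := by
  obtain ⟨a, ha⟩ := exists_hammingDist_eq_projDist φ ψ
  obtain ⟨b, hb⟩ := exists_hammingDist_eq_projDist ψ χ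
  calc projDist φ χ ≤ hammingDist φ ((a * b) • χ) := projDist_le φ χ (a * b)
    _ ≤ hammingDist φ (a • ψ) + hammingDist (a • ψ) ((a * b) • χ) := hammingDist_triangle _ _ _
    _ = projDist φ ψ + projDist ψ χ := by rw [mul_smul, hammingDist_units_smul, ha, hb]

theorem projDist_units_smul_left (a : (ZMod p)ˣ) (φ ψ : Fin n → ZMod p) :
    projDist (a • φ) ψ = projDist φ ψ := by
  have hle (a : (ZMod p)ˣ) (φ : Fin n → ZMod p) : projDist (a • φ) ψ ≤ projDist φ ψ := by
    obtain ⟨b, hb⟩ := exists_hammingDist_eq_projDist φ ψ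
    rw [← hb, ← hammingDist_units_smul a, smul_smul]
    exact projDist_le _ _ _
  exact (hle a φ).antisymm (by simpa using hle a⁻¹ (a • φ))

end ProjectiveDistance

section Structure

variable {n p r : ℕ} [NeZero p] {δ η θ : ℝ} {A : Finset (Cube n)} {φ : Fin n → ZMod p}

/-- Some unit multiple of `φ` has bias at least `η` on `A`. -/
def IsStructured (A : Finset (Cube n)) (η : ℝ) (φ : Fin n → ZMod p) : Prop :=
  ∃ a : (ZMod p)ˣ, η ≤ ‖coeff A (a • φ) ∅‖

theorem abs_distr_sub_inv_le_of_not_isStructured [Fact p.Prime] (hA : A.Nonempty)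
    (h : ¬ IsStructured A η φ) (d : ZMod p) : |distr A (subsetSum φ) d - (p : ℝ)⁻¹| ≤ η := by
  simp only [IsStructured, not_exists, not_le] at h
  exact abs_distr_subsetSum_sub_inv_le hA ((norm_nonneg _).trans (h 1).le)
    (fun c hc => (h (Units.mk0 c hc)).le) d

theorem exists_centers (hδ : 0 < δ) (hη : 0 < η) (hr : IsDecayRadius p r (δ * η ^ 2 / 2))
    (hA : δ ≤ density A) :
    ∃ C : Finset (Fin n → ZMod p), #C ≤ ⌊2 / (δ * η ^ 2)⌋₊ ∧
      ∀ φ, IsStructured A η φ → ∃ ψ ∈ C, projDist φ ψ ≤ r := by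
  classical
  obtain ⟨C, hC, hsep, hdom⟩ := exists_pairwise_not_of_refl_of_symm
    {φ : Fin n → ZMod p | η ≤ ‖coeff A φ ∅‖} (R := fun φ ψ => projDist φ ψ ≤ r)
    (fun φ => by simp [projDist_self]) fun φ ψ h => by rwa [projDist_comm]
  refine ⟨C, card_le_of_le_norm_coeff_of_le_hammingDist hδ hη hr hA
    (fun φ hφ => (mem_filter.1 (hC hφ)).2) fun φ hφ ψ hψ hne =>
      (not_le.1 (hsep hφ hψ hne)).le.trans (projDist_le_hammingDist φ ψ), fun φ ⟨a, ha⟩ => ?_⟩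
  obtain ⟨ψ, hψ, hdist⟩ := hdom (a • φ) (mem_filter.2 ⟨mem_univ _, ha⟩)
  exact ⟨ψ, hψ, projDist_units_smul_left a φ ψ ▸ hdist⟩

open Classical in
/-- The coordinates occurring in some set of size at most `R` whose Walsh function correlates on
`A`, up to `θ`, with a multiple of a form in `V`. -/
noncomputable def structuredCoords (A : Finset (Cube n)) (θ : ℝ) (R : ℕ)
    (V : Finset (Fin n → ZMod p)) : Finset (Fin n) :=
  (V ×ˢ (univ : Finset (ZMod p))).biUnion fun va =>
    Finset.biUnion {T | #T ≤ R ∧ θ ≤ ‖coeff A (va.2 • va.1) T‖} id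

theorem mem_structuredCoords {R : ℕ} {V : Finset (Fin n → ZMod p)} {z : Fin n} :
    z ∈ structuredCoords A θ R V ↔
      ∃ v ∈ V, ∃ a : ZMod p, ∃ T : Finset (Fin n), #T ≤ R ∧ θ ≤ ‖coeff A (a • v) T‖ ∧ z ∈ T := by
  simp only [structuredCoords, mem_biUnion, mem_product, mem_filter, mem_univ, true_and, and_true,
    Prod.exists, id]
  grind

theorem structuredCoords_mono {V V' : Finset (Fin n → ZMod p)} (R : ℕ) (h : V ⊆ V') :
    structuredCoords A θ R V ⊆ structuredCoords A θ R V' :=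
  biUnion_subset_biUnion_of_subset_left _ (product_subset_product_left h)

theorem card_structuredCoords_le (hδ : 0 < δ) (hθ : 0 < θ) (hA : δ ≤ density A) (R : ℕ)
    (V : Finset (Fin n → ZMod p)) :
    #(structuredCoords A θ R V) ≤ #V * p * (⌊1 / (δ * θ ^ 2)⌋₊ * R) := by
  classical
  refine (card_biUnion_le_card_mul _ _ (⌊1 / (δ * θ ^ 2)⌋₊ * R) fun va _ => ?_).trans_eq
    (by rw [card_product, card_univ, ZMod.card])
  refine (card_biUnion_le_card_mul _ _ R fun T hT => (mem_filter.1 hT).2.1).trans ?_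
  gcongr
  exact card_le_of_le_norm_coeff_walsh hδ hθ hA _ fun T hT => (mem_filter.1 hT).2.2

end Structure

section PopularValues

variable {n : ℕ} {A : Finset (Cube n)} {D E : Type*} [DecidableEq D] [DecidableEq E]

theorem exists_mem_of_distr_ne_zero {F : Cube n → D} {d : D} (h : distr A F d ≠ 0) :
    ∃ x ∈ A, F x = d := by
  by_contra! hne
  exact h (by rw [distr, filter_false_of_mem hne, card_empty, Nat.cast_zero, zero_div])

theorem sum_distr [Fintype D] (hA : A.Nonempty) (F : Cube n → D) : ∑ d, distr A F d = 1 := by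
  have hcard : (#A : ℝ) ≠ 0 := by exact_mod_cast hA.card_ne_zero
  simp only [distr]
  rw [← sum_div, ← Nat.cast_sum, ← card_eq_sum_card_fiberwise fun _ _ => mem_coe.2 (mem_univ _),
    div_self hcard]

theorem sum_distr_prod [Fintype E] (A : Finset (Cube n)) (F : Cube n → D) (G : Cube n → E)
    (d : D) : ∑ e, distr A (fun x => (F x, G x)) (d, e) = distr A F d := by
  simp only [distr, Prod.mk.injEq]
  rw [← sum_div, ← Nat.cast_sum]
  simp only [← filter_filter]
  rw [← card_eq_sum_card_fiberwise fun _ _ => mem_coe.2 (mem_univ _)]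

theorem exists_inv_card_le_distr [Fintype D] [Nonempty D] (hA : A.Nonempty) (F : Cube n → D) :
    ∃ d, (Fintype.card D : ℝ)⁻¹ ≤ distr A F d := by
  obtain ⟨d, -, hd⟩ := exists_le_of_sum_le (s := univ) (f := fun _ => (Fintype.card D : ℝ)⁻¹)
    (g := distr A F) univ_nonempty (by simp [sum_distr hA])
  exact ⟨d, hd⟩

theorem exists_inv_card_mul_distr_le_distr_prod [Fintype E] [Nonempty E] (A : Finset (Cube n))
    (F : Cube n → D) (G : Cube n → E) (d : D) :
    ∃ e, (Fintype.card E : ℝ)⁻¹ * distr A F d ≤ distr A (fun x => (F x, G x)) (d, e) := by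
  obtain ⟨e, -, he⟩ := exists_le_of_sum_le (s := univ)
    (f := fun _ => (Fintype.card E : ℝ)⁻¹ * distr A F d)
    (g := fun e => distr A (fun x => (F x, G x)) (d, e)) univ_nonempty (by simp [sum_distr_prod])
  exact ⟨e, he⟩

theorem exists_subset_forall_inv_card_le_distr [Fintype D] [Nonempty D] {ι κ : Type*}
    [Fintype κ] {Q : Finset ι} {A : ι → Finset (Cube n)} (hA : ∀ j ∈ Q, (A j).Nonempty)
    (F : κ → Cube n → D) :
    ∃ Q' ⊆ Q, #Q ≤ Fintype.card D ^ Fintype.card κ * #Q' ∧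
      ∀ k, ∃ d, ∀ j ∈ Q', (Fintype.card D : ℝ)⁻¹ ≤ distr (A j) (F k) d := by
  classical
  obtain ⟨f, -, Q', hQ', hcard, hf⟩ := exists_subset_card_le_mul_card (t := univ)
    (r := fun j (f : κ → D) => ∀ k, (Fintype.card D : ℝ)⁻¹ ≤ distr (A j) (F k) (f k))
    univ_nonempty fun j hj => by
      choose f hf using fun k => exists_inv_card_le_distr (hA j hj) (F k)
      exact ⟨f, mem_univ _, hf⟩
  rw [card_univ, Fintype.card_fun] at hcard
  exact ⟨Q', hQ', hcard, fun k => ⟨f k, fun j hj => hf j hj k⟩⟩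

theorem inv_two_pow_le_distr_univ_subsetSum {G : Type*} [AddCommGroup G] [Fintype G]
    [DecidableEq G] (g : Fin n → G) (y : Cube n) :
    ((2 : ℝ) ^ (Fintype.card G - 1))⁻¹ ≤ distr univ (subsetSum g) (subsetSum g y) := by
  rw [distr, inv_le_iff_one_le_mul₀' (by positivity), ← mul_div_assoc,
    one_le_div (by simp), mul_comm]
  simpa using (Nat.cast_le (α := ℝ)).2 (two_pow_le_card_fiber g y)

end PopularValues

section CommonValues

variable {n p R : ℕ} [NeZero p] {θ : ℝ} {A : Finset (Cube n)} {ω χ : Fin n → ZMod p}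

theorem abs_distr_indicator_sub_mul_distr_le {Z W : Set (Fin n)} (hZW : Z ⊆ W) (hθ₀ : 0 ≤ θ)
    (hW : ∀ b : ZMod p, ∀ T : Finset (Fin n), #T ≤ R → θ < ‖coeff A (b • ω) T‖ → ↑T ⊆ W)
    (hχ : hammingNorm χ ≤ R) (d c e : ZMod p) :
    |distr A (fun x => ((subsetSum (ω + Z.indicator χ) x, subsetSum ((W \ Z).indicator χ) x),
        subsetSum (Wᶜ.indicator χ) x)) ((d, c), e) -
      distr A (fun x => (subsetSum (ω + Z.indicator χ) x, subsetSum ((W \ Z).indicator χ) x))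
        (d, c) * distr univ (subsetSum (Wᶜ.indicator χ)) e| ≤ 2 ^ R * θ := by
  classical
  set S : Finset (Fin n) := {z | χ z ≠ 0 ∧ z ∈ W} with hS
  set S' : Finset (Fin n) := {z | χ z ≠ 0 ∧ z ∉ W} with hS'
  have hdisj : Disjoint S S' := disjoint_filter.2 fun z _ h h' => h'.2 h.2
  have hcard : #(S ∪ S') ≤ R := by
    refine (card_le_card fun z hz => ?_).trans hχ
    simp only [hS, hS', mem_union, mem_filter, mem_univ, true_and] at hz ⊢
    exact hz.elim And.left And.left
  have hcoeff (b : ZMod p) (T) (hT : T ⊆ S ∪ S') (hTS : ¬ T ⊆ S) : ‖coeff A (b • ω) T‖ ≤ θ := by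
    by_contra! hlarge
    refine hTS fun z hz => ?_
    have hzW := hW b T ((card_le_card hT).trans hcard) hlarge hz
    have := hT hz
    grind
  have hind := abs_distr_prod_sub_mul_distr_le hdisj hθ₀ hcoeff
    (dependsOn_subsetSum (g := Z.indicator χ) fun z hz => by
      rw [Set.support_indicator] at hz; simpa [hS] using ⟨hz.2, hZW hz.1⟩)
    (dependsOn_subsetSum (g := (W \ Z).indicator χ) fun z hz => by
      rw [Set.support_indicator] at hz; simpa [hS] using ⟨hz.2, hz.1.1⟩)
    (dependsOn_subsetSum (g := Wᶜ.indicator χ) fun z hz => by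
      rw [Set.support_indicator] at hz; simpa [hS'] using ⟨hz.2, hz.1⟩)
    d c e
  simp only [← subsetSum_add, ← card_union_of_disjoint hdisj] at hind
  refine hind.trans ?_
  gcongr
  norm_num

theorem mul_inv_two_pow_sub_le_distr_subsetSum_add {Z W : Set (Fin n)} (hZW : Z ⊆ W)
    (hθ₀ : 0 ≤ θ)
    (hW : ∀ b : ZMod p, ∀ T : Finset (Fin n), #T ≤ R → θ < ‖coeff A (b • ω) T‖ → ↑T ⊆ W)
    (hχ : hammingNorm χ ≤ R) (d c : ZMod p) (y : Cube n) :
    distr A (fun x => (subsetSum (ω + Z.indicator χ) x, subsetSum ((W \ Z).indicator χ) x)) (d, c) *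
      ((2 : ℝ) ^ (p - 1))⁻¹ - 2 ^ R * θ ≤
      distr A (subsetSum (ω + χ)) (d + c + subsetSum (Wᶜ.indicator χ) y) := by
  have hind := abs_distr_indicator_sub_mul_distr_le hZW hθ₀ hW hχ d c
    (subsetSum (Wᶜ.indicator χ) y)
  have hsplit : Z.indicator χ + (W \ Z).indicator χ + Wᶜ.indicator χ = χ := by
    rw [add_comm (Z.indicator χ), Set.indicator_sdiff hZW, sub_add_cancel,
      Set.indicator_self_add_compl]
  have hfull : distr A (fun x => ((subsetSum (ω + Z.indicator χ) x,
      subsetSum ((W \ Z).indicator χ) x), subsetSum (Wᶜ.indicator χ) x))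
        ((d, c), subsetSum (Wᶜ.indicator χ) y) ≤
      distr A (subsetSum (ω + χ)) (d + c + subsetSum (Wᶜ.indicator χ) y) :=
    distr_le_distr fun x hx => by
      simp only [Prod.mk.injEq] at hx
      rw [← hx.1.1, ← hx.1.2, ← hx.2, ← subsetSum_add, ← subsetSum_add, add_assoc, add_assoc,
        ← add_assoc (Z.indicator χ), hsplit]
  have huniv : ((2 : ℝ) ^ (p - 1))⁻¹ ≤
      distr univ (subsetSum (Wᶜ.indicator χ)) (subsetSum (Wᶜ.indicator χ) y) := by
    simpa [ZMod.card] using inv_two_pow_le_distr_univ_subsetSum (Wᶜ.indicator χ) y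
  have hmul := mul_le_mul_of_nonneg_left huniv (distr_nonneg A (fun x =>
    (subsetSum (ω + Z.indicator χ) x, subsetSum ((W \ Z).indicator χ) x)) (d, c))
  linarith [(abs_le.1 hind).1]

/-- The common value is `d₀ + ∑ t, c t`, where `c t` is popular for the part of `χ` on
`W t \ Z`: these parts are independent inside the cube, so the part of `χ` off `W t` attains the
sum of the other `c s`, and `A t` cannot distinguish it from a function of a uniform point. -/
theorem exists_forall_le_distr_subsetSum_add {τ : Type*} [Finite τ] {A : τ → Finset (Cube n)}
    {Z : Set (Fin n)} {W : τ → Set (Fin n)} (hZW : ∀ t, Z ⊆ W t)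
    (hWW : Pairwise (Function.onFun Disjoint fun t => W t \ Z)) (hθ₀ : 0 ≤ θ)
    (hW : ∀ t, ∀ b : ZMod p, ∀ T : Finset (Fin n), #T ≤ R → θ < ‖coeff (A t) (b • ω) T‖ →
      ↑T ⊆ W t) (hχ : hammingNorm χ ≤ R) {d₀ : ZMod p}
    (hd₀ : ∀ t, (p : ℝ)⁻¹ ≤ distr (A t) (subsetSum (ω + Z.indicator χ)) d₀) :
    ∃ d, ∀ t, ((p : ℝ) ^ 2 * 2 ^ (p - 1))⁻¹ - 2 ^ R * θ ≤
      distr (A t) (subsetSum (ω + χ)) d := by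
  classical
  cases nonempty_fintype τ
  have hp : (0 : ℝ) < (p : ℝ)⁻¹ := inv_pos.2 (Nat.cast_pos.2 (NeZero.pos p))
  obtain ⟨c, hc⟩ : ∃ c : τ → ZMod p, ∀ t, ((p : ℝ) ^ 2)⁻¹ ≤ distr (A t) (fun x =>
      (subsetSum (ω + Z.indicator χ) x, subsetSum ((W t \ Z).indicator χ) x)) (d₀, c t) := by
    choose c hc using fun t => exists_inv_card_mul_distr_le_distr_prod (A t)
      (subsetSum (ω + Z.indicator χ)) (subsetSum ((W t \ Z).indicator χ)) d₀
    refine ⟨c, fun t => le_trans ?_ (hc t)⟩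
    rw [ZMod.card, sq, mul_inv]
    exact mul_le_mul_of_nonneg_left (hd₀ t) hp.le
  obtain ⟨x, hx⟩ : ∃ x : τ → Cube n, ∀ t, subsetSum ((W t \ Z).indicator χ) (x t) = c t := by
    choose x _ hx using fun t => exists_mem_of_distr_ne_zero
      (lt_of_lt_of_le (by rw [← inv_pow]; positivity) (hc t)).ne'
    exact ⟨x, fun t => (Prod.mk.inj (hx t)).2⟩
  refine ⟨d₀ + ∑ t, c t, fun t => ?_⟩
  obtain ⟨y, hy⟩ := exists_subsetSum_indicator_eq_sum (I := univ.erase t) (Y := (W t)ᶜ)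
    (hWW.set_pairwise _) (fun s hs z hz hzt => Set.disjoint_left.1 (hWW (ne_of_mem_erase hs)) hz
      ⟨hzt, hz.2⟩) χ x
  have hvalue : d₀ + ∑ s, c s = d₀ + c t + subsetSum ((W t)ᶜ.indicator χ) y := by
    rw [hy, sum_congr rfl fun s _ => hx s, add_assoc, add_sum_erase _ _ (mem_univ t)]
  rw [hvalue, mul_inv]
  refine le_trans ?_ (mul_inv_two_pow_sub_le_distr_subsetSum_add (hZW t) hθ₀ (hW t) hχ d₀ (c t) y)
  gcongr
  exact hc t

theorem exists_forall_le_distr_of_pairwise_not_isStructured [Fact p.Prime] {τ : Type*}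
    {A : τ → Finset (Cube n)} {η : ℝ} {φ : Fin n → ZMod p} (hA : ∀ t, (A t).Nonempty)
    (hη : 0 ≤ η)
    (h : Pairwise fun t t' => ¬ (IsStructured (A t) η φ ∧ IsStructured (A t') η φ)) :
    ∃ d, ∀ t, (p : ℝ)⁻¹ - η ≤ distr (A t) (subsetSum φ) d := by
  have hunif (t) (ht : ¬ IsStructured (A t) η φ) (d) : (p : ℝ)⁻¹ - η ≤
      distr (A t) (subsetSum φ) d := by
    linarith [(abs_le.1 (abs_distr_sub_inv_le_of_not_isStructured (hA t) ht d)).1]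
  by_cases hstr : ∃ t, IsStructured (A t) η φ
  · obtain ⟨t, ht⟩ := hstr
    obtain ⟨d, hd⟩ := exists_inv_card_le_distr (hA t) (subsetSum φ)
    rw [ZMod.card] at hd
    refine ⟨d, fun t' => ?_⟩
    obtain rfl | hne := eq_or_ne t t'
    · linarith
    · exact hunif t' (fun ht' => h hne ⟨ht, ht'⟩) d
  · push Not at hstr
    exact ⟨0, fun t => hunif t (hstr t) 0⟩

end CommonValues

/-- The structure shared by a family of subsets of the cube: separated forms, each close to one
that is structured on every member, and coordinates correlating with these forms on every member
(see `Skeleton.Fits`). -/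
structure Skeleton (n p : ℕ) where
  forms : Finset (Fin n → ZMod p)
  coords : Finset (Fin n)

namespace Skeleton

variable {n p r : ℕ} [NeZero p] {δ ε η θ : ℝ} {A : Finset (Cube n)} {s : Skeleton n p}

/-- The number of forms and coordinates of a skeleton. -/
def rank (s : Skeleton n p) : ℕ := #s.forms + #s.coords

/-- The set `A` has all the structure recorded by `s`; `η` and `θ` are the thresholds for
structured forms and for structured coordinates, and `r` is the radius up to which forms are
identified. -/
structure Fits (η θ : ℝ) (r : ℕ) (s : Skeleton n p) (A : Finset (Cube n)) : Prop where
  separated : (s.forms : Set (Fin n → ZMod p)).Pairwise fun v w => 3 * r < projDist v w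
  near : ∀ v ∈ s.forms, ∃ φ, projDist φ v ≤ r ∧ IsStructured A η φ
  coords_subset : s.coords ⊆ structuredCoords A θ (4 * r) s.forms

/-- The sets `A` and `A'` share structure that `s` does not record: a form far from the forms of
`s`, or a coordinate. -/
def Links (η θ : ℝ) (r : ℕ) (s : Skeleton n p) (A A' : Finset (Cube n)) : Prop :=
  (∃ φ, IsStructured A η φ ∧ IsStructured A' η φ ∧ ∀ v ∈ s.forms, 4 * r < projDist φ v) ∨
    ∃ z ∉ s.coords, z ∈ structuredCoords A θ (4 * r) s.forms ∧
      z ∈ structuredCoords A' θ (4 * r) s.forms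

/-- A bound on the rank of a skeleton fitting a set of density `δ`. -/
noncomputable def rankBound (p r : ℕ) (δ η θ : ℝ) : ℕ :=
  ⌊2 / (δ * η ^ 2)⌋₊ + ⌊2 / (δ * η ^ 2)⌋₊ * p * (⌊1 / (δ * θ ^ 2)⌋₊ * (4 * r))

theorem Fits.card_forms_le (hδ : 0 < δ) (hη : 0 < η) (hr : IsDecayRadius p r (δ * η ^ 2 / 2))
    (hA : δ ≤ density A) (h : s.Fits η θ r A) : #s.forms ≤ ⌊2 / (δ * η ^ 2)⌋₊ := by
  have hnear (v) (hv : v ∈ s.forms) : ∃ φ, projDist φ v ≤ r ∧ η ≤ ‖coeff A φ ∅‖ := by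
    obtain ⟨φ, hφv, a, ha⟩ := h.near v hv
    exact ⟨a • φ, (projDist_units_smul_left a φ v).trans_le hφv, ha⟩
  choose! f hfv hf using hnear
  have hsep (v) (hv : v ∈ s.forms) (w) (hw : w ∈ s.forms) (hvw : v ≠ w) :
      r < hammingDist (f v) (f w) := by
    have hv' := projDist_comm v (f v) ▸ hfv v hv
    have := h.separated hv hw hvw
    have := projDist_triangle v (f v) w
    have := projDist_triangle (f v) (f w) w
    have := projDist_le_hammingDist (f v) (f w)
    have := hfv w hw
    omega
  have hinj : Set.InjOn f s.forms := fun v hv w hw hvw => by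
    by_contra hne
    simpa [hvw] using hsep v hv w hw hne
  rw [← card_image_of_injOn hinj]
  refine card_le_of_le_norm_coeff_of_le_hammingDist hδ hη hr hA ?_ ?_
  · simpa only [forall_mem_image] using hf
  · rw [coe_image, hinj.pairwise_image]
    exact fun v hv w hw hvw => (hsep v hv w hw hvw).le

theorem Fits.card_structuredCoords_add_le_rankBound (hδ : 0 < δ) (hη : 0 < η) (hθ : 0 < θ)
    (hr : IsDecayRadius p r (δ * η ^ 2 / 2)) (hA : δ ≤ density A) (h : s.Fits η θ r A) :
    ⌊2 / (δ * η ^ 2)⌋₊ + #(structuredCoords A θ (4 * r) s.forms) ≤ rankBound p r δ η θ := by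
  refine Nat.add_le_add_left ((card_structuredCoords_le hδ hθ hA _ _).trans ?_) _
  gcongr
  exact h.card_forms_le hδ hη hr hA

theorem Fits.rank_le_rankBound (hδ : 0 < δ) (hη : 0 < η) (hθ : 0 < θ)
    (hr : IsDecayRadius p r (δ * η ^ 2 / 2)) (hA : δ ≤ density A) (h : s.Fits η θ r A) :
    s.rank ≤ rankBound p r δ η θ :=
  (Nat.add_le_add (h.card_forms_le hδ hη hr hA) (card_le_card h.coords_subset)).trans
    (h.card_structuredCoords_add_le_rankBound hδ hη hθ hr hA)

theorem Fits.insert_form (h : s.Fits η θ r A) {φ ψ : Fin n → ZMod p} (hφ : IsStructured A η φ)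
    (hφψ : projDist φ ψ ≤ r) (hfar : ∀ v ∈ s.forms, 4 * r < projDist φ v) :
    (Skeleton.mk (insert ψ s.forms) s.coords).Fits η θ r A where
  separated := by
    have hψ (v) (hv : v ∈ s.forms) : 3 * r < projDist ψ v := by
      have := hfar v hv
      have := projDist_triangle φ ψ v
      omega
    rw [coe_insert, Set.pairwise_insert]
    exact ⟨h.separated, fun v hv _ => ⟨hψ v hv, projDist_comm ψ v ▸ hψ v hv⟩⟩
  near := forall_mem_insert _ _ _ |>.2 ⟨⟨φ, hφψ, hφ⟩, h.near⟩
  coords_subset := h.coords_subset.trans (structuredCoords_mono _ (subset_insert ψ s.forms))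

theorem Fits.insert_coord (h : s.Fits η θ r A) {z : Fin n}
    (hz : z ∈ structuredCoords A θ (4 * r) s.forms) :
    (Skeleton.mk s.forms (insert z s.coords)).Fits η θ r A :=
  ⟨h.separated, h.near, insert_subset hz h.coords_subset⟩

theorem Fits.exists_extensions (hδ : 0 < δ) (hη : 0 < η) (hθ : 0 < θ)
    (hr : IsDecayRadius p r (δ * η ^ 2 / 2)) (hA : δ ≤ density A) (h : s.Fits η θ r A) :
    ∃ O : Finset (Skeleton n p), #O ≤ rankBound p r δ η θ ∧ (∀ s' ∈ O, s.rank < s'.rank) ∧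
      ∀ A', s.Fits η θ r A' → s.Links η θ r A A' → ∃ s' ∈ O, s'.Fits η θ r A' := by
  classical
  obtain ⟨C, hC, hcentre⟩ := exists_centers hδ hη hr hA
  let addForm (ψ : Fin n → ZMod p) : Skeleton n p := ⟨insert ψ s.forms, s.coords⟩
  let addCoord (z : Fin n) : Skeleton n p := ⟨s.forms, insert z s.coords⟩
  refine ⟨(C \ s.forms).image addForm ∪
    (structuredCoords A θ (4 * r) s.forms \ s.coords).image addCoord, ?_, fun s' hs' => ?_,
    fun A' h' hlink => ?_⟩
  · refine le_trans ?_ (h.card_structuredCoords_add_le_rankBound hδ hη hθ hr hA)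
    refine (card_union_le _ _).trans (Nat.add_le_add ?_ ?_)
    · exact card_image_le.trans ((card_le_card sdiff_subset).trans hC)
    · exact card_image_le.trans (card_le_card sdiff_subset)
  · simp only [mem_union, mem_image, mem_sdiff] at hs'
    rcases hs' with ⟨ψ, ⟨-, hψ⟩, rfl⟩ | ⟨z, ⟨-, hz⟩, rfl⟩
    · simp only [rank, addForm, card_insert_of_notMem hψ]
      omega
    · simp only [rank, addCoord, card_insert_of_notMem hz]
      omega
  · rcases hlink with ⟨φ, hφ, hφ', hfar⟩ | ⟨z, hz, hzA, hz_other⟩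
    · obtain ⟨ψ, hψ, hφψ⟩ := hcentre φ hφ
      have hψs : ψ ∉ s.forms := fun hmem => by
        have := hfar ψ hmem
        omega
      exact ⟨addForm ψ, mem_union_left _ (mem_image_of_mem _ (mem_sdiff.2 ⟨hψ, hψs⟩)),
        h'.insert_form hφ' hφψ hfar⟩
    · exact ⟨addCoord z, mem_union_right _ (mem_image_of_mem _ (mem_sdiff.2 ⟨hzA, hz⟩)),
        h'.insert_coord hz_other⟩

/-- Every form assembled from a multiple of a form of `s` and from a form supported on the
coordinates of `s` has a common popular value on the sets `A j` with `j ∈ Q`. -/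
def HasCommonValues {ι : Type*} (s : Skeleton n p) (A : ι → Finset (Cube n)) (Q : Finset ι) :
    Prop :=
  ∀ v ∈ s.forms, ∀ (a : ZMod p) (χ : Fin n → ZMod p), ∃ d, ∀ j ∈ Q,
    (p : ℝ)⁻¹ ≤ distr (A j) (subsetSum (a • v + (s.coords : Set (Fin n)).indicator χ)) d

theorem exists_subset_hasCommonValues {ι : Type*} (s : Skeleton n p) {A : ι → Finset (Cube n)}
    {Q : Finset ι} (hA : ∀ j ∈ Q, (A j).Nonempty) :
    ∃ Q' ⊆ Q, #Q ≤ p ^ (#s.forms * (p * p ^ #s.coords)) * #Q' ∧ s.HasCommonValues A Q' := by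
  obtain ⟨Q', hQ', hcard, hval⟩ := exists_subset_forall_inv_card_le_distr hA
    (fun k : s.forms × ZMod p × (s.coords → ZMod p) =>
      subsetSum (k.2.1 • (k.1 : Fin n → ZMod p) +
        fun z => if hz : z ∈ s.coords then k.2.2 ⟨z, hz⟩ else 0))
  simp only [Fintype.card_prod, Fintype.card_fun, Fintype.card_coe, ZMod.card] at hcard hval
  refine ⟨Q', hQ', hcard, fun v hv a χ => ?_⟩
  have hext : (fun z => if _ : z ∈ s.coords then χ z else 0) =
      (s.coords : Set (Fin n)).indicator χ := by
    ext z
    simp only [Set.indicator, mem_coe, dite_eq_ite]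
  simpa only [hext] using hval (⟨v, hv⟩, a, fun z => χ z)

theorem exists_stable (hδ : 0 < δ) (hη : 0 < η) (hθ : 0 < θ)
    (hr : IsDecayRadius p r (δ * η ^ 2 / 2)) (hε : 0 < ε) :
    ∃ c : ℝ, 0 < c ∧ ∀ {n : ℕ} {ι : Type*} (A : ι → Finset (Cube n)),
      (∀ j, δ ≤ density (A j)) → ∀ Q₀ : Finset ι, ∃ s : Skeleton n p, ∃ Q : Finset ι,
        c * #Q₀ ≤ #Q ∧ (∀ j ∈ Q, s.Fits η θ r (A j)) ∧
        open Classical in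
        #(Rel.interedges (fun i j => s.Links η θ r (A i) (A j)) Q Q) ≤ ε * #Q * #Q := by
  set N := rankBound p r δ η θ
  set a : ℝ := ε / (N + ε + 1)
  have ha₁ : a ≤ 1 := div_le_one_of_le₀ (by linarith [N.cast_nonneg (α := ℝ)]) (by positivity)
  have haε : N * a ≤ ε := by
    rw [mul_div_left_comm]
    exact mul_le_of_le_one_right hε.le (div_le_one_of_le₀ (by linarith) (by positivity))
  refine ⟨a ^ (N + 1), by positivity, fun A hA Q₀ => ?_⟩
  refine exists_stable_state (rank := rank) (fits := fun s j => s.Fits η θ r (A j))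
    (linked := fun s i j => s.Links η θ r (A i) (A j)) (by positivity) ha₁ haε
    (fun s j h => h.rank_le_rankBound hδ hη hθ hr (hA j)) (fun s i h => ?_) (N + 1) ⟨∅, ∅⟩
    (by simp only [rank, card_empty]; omega) Q₀ fun j _ => ⟨by simp, by simp, by simp⟩
  obtain ⟨O, hO, hrank, hfits⟩ := h.exists_extensions hδ hη hθ hr (hA i)
  exact ⟨O, hO, hrank, fun j => hfits (A j)⟩

theorem exists_stable_hasCommonValues (hδ : 0 < δ) (hη : 0 < η) (hθ : 0 < θ)
    (hr : IsDecayRadius p r (δ * η ^ 2 / 2)) (hε : 0 < ε) :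
    ∃ c : ℝ, 0 < c ∧ ∀ {n : ℕ} {ι : Type*} (A : ι → Finset (Cube n)),
      (∀ j, δ ≤ density (A j)) → ∀ Q₀ : Finset ι, ∃ s : Skeleton n p, ∃ Q : Finset ι,
        c * #Q₀ ≤ #Q ∧ (∀ j ∈ Q, s.Fits η θ r (A j)) ∧ s.HasCommonValues A Q ∧
        open Classical in
        #(Rel.interedges (fun i j => s.Links η θ r (A i) (A j)) Q Q) ≤ ε * #Q * #Q := by
  classical
  set N := rankBound p r δ η θ
  set k : ℝ := (p : ℝ) ^ (N * (p * p ^ N))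
  have hp : 1 ≤ p := NeZero.one_le
  have hk : 0 < k := pow_pos (by exact_mod_cast hp) _
  obtain ⟨c, hc, hstable⟩ := exists_stable hδ hη hθ hr (ε := ε / k ^ 2) (by positivity)
  refine ⟨c / k, by positivity, fun A hA Q₀ => ?_⟩
  obtain ⟨s, Q, hQ, hfits, hlinks⟩ := hstable A hA Q₀
  obtain ⟨Q', hQ', hcard, hval⟩ :=
    s.exists_subset_hasCommonValues (Q := Q) fun j _ => nonempty_of_le_density hδ (hA j)
  have hrefined : (#Q : ℝ) ≤ k * #Q' := by
    obtain rfl | ⟨j, hj⟩ := Q.eq_empty_or_nonempty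
    · simp only [card_empty, Nat.cast_zero]
      positivity
    · have hrank : #s.forms + #s.coords ≤ N :=
        (hfits j hj).rank_le_rankBound hδ hη hθ hr (hA j)
      have hexp : #s.forms * (p * p ^ #s.coords) ≤ N * (p * p ^ N) := by
        gcongr <;> omega
      refine le_trans (by exact_mod_cast hcard)
        (mul_le_mul_of_nonneg_right (pow_le_pow_right₀ (by exact_mod_cast hp) hexp) (by positivity))
  refine ⟨s, Q', ?_, fun j hj => hfits j (hQ' hj), hval, ?_⟩
  · rw [div_mul_eq_mul_div, div_le_iff₀' hk]
    exact hQ.trans hrefined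
  · calc _ ≤ ε / k ^ 2 * #Q * #Q := le_trans (by gcongr; exact Rel.interedges_mono hQ' hQ') hlinks
      _ ≤ ε / k ^ 2 * (k * #Q') * (k * #Q') := by gcongr
      _ = ε * #Q' * #Q' := by field_simp

end Skeleton

theorem Skeleton.HasCommonValues.exists_forall_le_distr {n p r : ℕ} [Fact p.Prime] {η θ ν : ℝ}
    {s : Skeleton n p} {ι τ : Type*} [Finite τ] {A : ι → Finset (Cube n)} {Q : Finset ι}
    (hval : s.HasCommonValues A Q) (hA : ∀ j ∈ Q, (A j).Nonempty)
    (hfits : ∀ j ∈ Q, s.Fits η θ r (A j)) (hη : 0 ≤ η) (hην : η ≤ ν) (hθ : 0 ≤ θ)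
    (hθν : 2 ^ (4 * r) * θ ≤ ν) {i : τ → ι} (hi : ∀ t, i t ∈ Q)
    (hlinks : Pairwise fun t t' => ¬ s.Links η θ r (A (i t)) (A (i t'))) (φ : Fin n → ZMod p) :
    ∃ d, ∀ t, ((p : ℝ) ^ 2 * 2 ^ (p - 1))⁻¹ - ν ≤ distr (A (i t)) (subsetSum φ) d := by
  have hp : (1 : ℝ) ≤ p := by exact_mod_cast (Fact.out : p.Prime).one_le
  by_cases hstr : Pairwise fun t t' =>
    ¬ (IsStructured (A (i t)) η φ ∧ IsStructured (A (i t')) η φ)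
  · obtain ⟨d, hd⟩ :=
      exists_forall_le_distr_of_pairwise_not_isStructured (fun t => hA (i t) (hi t)) hη hstr
    refine ⟨d, fun t => (sub_le_sub ?_ hην).trans (hd t)⟩
    have hpow : (1 : ℝ) ≤ 2 ^ (p - 1) := one_le_pow₀ one_le_two
    gcongr
    nlinarith
  · simp only [Pairwise, not_forall, not_not] at hstr
    obtain ⟨t, t', hne, ht, ht'⟩ := hstr
    obtain ⟨v, hv, hφv⟩ : ∃ v ∈ s.forms, projDist φ v ≤ 4 * r := by
      by_contra! hfar
      exact hlinks hne (Or.inl ⟨φ, ht, ht', hfar⟩)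
    obtain ⟨a, ha⟩ := exists_hammingDist_eq_projDist φ v
    set χ := φ - (a : ZMod p) • v with hχ
    have hχr : hammingNorm χ ≤ 4 * r := by
      rw [hχ, sub_eq_neg_add, ← hammingDist_eq_hammingNorm, hammingDist_comm, ← Units.smul_def, ha]
      exact hφv
    obtain ⟨d₀, hd₀⟩ := hval v hv a χ
    obtain ⟨d, hd⟩ := exists_forall_le_distr_subsetSum_add (A := fun t => A (i t))
      (W := fun t => structuredCoords (A (i t)) θ (4 * r) s.forms)
      (fun t => coe_subset.2 (hfits _ (hi t)).coords_subset)
      (fun t t' hne => Set.disjoint_left.2 fun z hz hz' =>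
        hlinks hne (Or.inr ⟨z, hz.2, hz.1, hz'.1⟩)) hθ
      (fun t b T hT hlarge z hz => mem_coe.2 <| mem_structuredCoords.2
        ⟨v, hv, b * (a : ZMod p), T, hT, by simpa only [mul_smul] using hlarge.le, hz⟩)
      hχr fun t => hd₀ (i t) (hi t)
    rw [hχ, add_sub_cancel] at hd
    exact ⟨d, fun t => (sub_le_sub le_rfl hθν).trans (hd t)⟩

theorem le_overlap {m : ℕ} [NeZero m] {D : Type*} [Fintype D] {X : Fin m → D → ℝ}
    (hX : ∀ t d, 0 ≤ X t d) {b : ℝ} {d : D} (h : ∀ t, b ≤ X t d) : b ≤ overlap X :=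
  (le_ciInf h).trans (single_le_sum (f := fun d => ⨅ t, X t d)
    (fun d _ => Real.iInf_nonneg fun t => hX t d) (mem_univ d))

theorem sq_mul_two_pow_le {p m : ℕ} (hp : 1 ≤ p) (hm : 2 ≤ m) :
    (p : ℝ) ^ 2 * 2 ^ (p - 1) ≤ 2 ^ ((m + 1) * (p - 1)) := by
  have hlt : p - 1 < 2 ^ (p - 1) := Nat.lt_two_pow_self
  have hp' : (p : ℝ) ≤ 2 ^ (p - 1) := by exact_mod_cast (by omega : p ≤ 2 ^ (p - 1))
  calc (p : ℝ) ^ 2 * 2 ^ (p - 1) ≤ (2 ^ (p - 1)) ^ 2 * 2 ^ (p - 1) := by gcongr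
    _ = 2 ^ (3 * (p - 1)) := by ring
    _ ≤ 2 ^ ((m + 1) * (p - 1)) := by
        gcongr
        · norm_num
        · omega

theorem inv_two_pow_sub_le_formOverlap {p m n : ℕ} [NeZero p] (hm : 2 ≤ m) {ν : ℝ}
    {A : Fin m → Finset (Cube n)} {φ : ModPForm p n}
    (h : ∃ d, ∀ t, ((p : ℝ) ^ 2 * 2 ^ (p - 1))⁻¹ - ν ≤ distr (A t) (fun x => φ (x.toZMod p)) d) :
    ((2 : ℝ) ^ ((m + 1) * (p - 1)))⁻¹ - ν ≤ formOverlap A φ := by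
  have : NeZero m := ⟨by omega⟩
  have hp := NeZero.pos p
  obtain ⟨d, hd⟩ := h
  refine le_overlap (fun t d => distr_nonneg _ _ d) fun t => (sub_le_sub_right ?_ ν).trans (hd t)
  exact inv_anti₀ (by positivity) (sq_mul_two_pow_le hp hm)

end ModPForms

theorem mainTheorem2_general (p : ℕ) [Fact p.Prime] (m : ℕ) (δ ν ε : ℝ) (hδ : 0 < δ)
    (hν : 0 < ν) (hε : 0 < ε) :
    ∃ c : ℝ, 0 < c ∧ ∀ (n s : ℕ) (A : Fin s → Finset (ModPForms.Cube n)),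
      (∀ i, δ ≤ ModPForms.density (A i)) →
      ∃ Q : Finset (Fin s), c * (s : ℝ) ≤ (Q.card : ℝ) ∧
        (1 - ε) * (Q.card : ℝ) ^ m ≤
          (Set.ncard {i : Fin m → Fin s | (∀ t, i t ∈ Q) ∧
            ∀ φ : ModPForms.ModPForm p n, ∃ d, ∀ t,
              ((p : ℝ) ^ 2 * 2 ^ (p - 1))⁻¹ - ν ≤
                ModPForms.distr (A (i t)) (fun x => φ (x.toZMod p)) d} : ℝ) := by
  classical
  obtain ⟨r, hr⟩ := ModPForms.exists_isDecayRadius p (by positivity : 0 < δ * ν ^ 2 / 2)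
  have hθ : 0 < ν / 2 ^ (4 * r) := by positivity
  obtain ⟨c, hc, hstable⟩ := ModPForms.Skeleton.exists_stable_hasCommonValues hδ hν hθ hr
    (by positivity : 0 < ε / (m ^ 2 + 1))
  refine ⟨c, hc, fun n s A hA => ?_⟩
  obtain ⟨skel, Q, hQ, hfits, hval, hlinks⟩ := hstable A hA Finset.univ
  refine ⟨Q, by simpa using hQ, ?_⟩
  have htuples := ModPForms.mul_card_pow_le_card_filter_pairwise (τ := Fin m) (by positivity) hlinks
  have hε' : (1 - ε) * (Q.card : ℝ) ^ m ≤ (1 - m ^ 2 * (ε / (m ^ 2 + 1))) * (Q.card : ℝ) ^ m := by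
    gcongr
    rw [mul_div_left_comm]
    exact mul_le_of_le_one_right hε.le (div_le_one_of_le₀ (by linarith) (by positivity))
  rw [Fintype.card_fin] at htuples
  refine (hε'.trans htuples).trans ?_
  rw [← Set.ncard_coe_finset]
  refine Nat.cast_le.2 (Set.ncard_le_ncard (fun i hi => ?_) (Set.toFinite _))
  obtain ⟨hiQ, hpair⟩ := Finset.mem_filter.1 (Finset.mem_coe.1 hi)
  have hiQ' := Fintype.mem_piFinset.1 hiQ
  refine ⟨hiQ', fun φ => ?_⟩
  simp only [ModPForms.apply_toZMod_eq_subsetSum]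
  exact hval.exists_forall_le_distr (fun j _ => ModPForms.nonempty_of_le_density hδ (hA j)) hfits
    hν.le le_rfl hθ.le (by field_simp; rfl) hiQ' hpair _

theorem mainTheorem2 (p : ℕ) [Fact p.Prime] (m : ℕ) (hm : 2 ≤ m)
    (δ ν ε : ℝ) (hδ : 0 < δ) (hν : 0 < ν) (hε : 0 < ε) :
    ∃ c : ℝ, 0 < c ∧
      ∀ (n s : ℕ), 1 ≤ n → 1 ≤ s →
      ∀ A : Fin s → Finset (ModPForms.Cube n),
        (∀ i, (A i).Nonempty) → (∀ i, δ ≤ ModPForms.density (A i)) →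
        ∃ Q : Finset (Fin s), c * (s : ℝ) ≤ (Q.card : ℝ) ∧
          (1 - ε) * (Q.card : ℝ) ^ m ≤
            (Set.ncard {i : Fin m → Fin s | (∀ t, i t ∈ Q) ∧
              ∀ φ : ModPForms.ModPForm p n,
                ((2 : ℝ) ^ ((m + 1) * (p - 1)))⁻¹ - ν ≤
                  ModPForms.formOverlap (fun t => A (i t)) φ} : ℝ) := by
  obtain ⟨c, hc, h⟩ := mainTheorem2_general p m δ ν ε hδ hν hε
  refine ⟨c, hc, fun n s _ _ A _ hA => ?_⟩
  obtain ⟨Q, hQ, htuples⟩ := h n s A hA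
  exact ⟨Q, hQ, htuples.trans (Nat.cast_le.2 (Set.ncard_le_ncard (fun i hi =>
    ⟨hi.1, fun φ => ModPForms.inv_two_pow_sub_le_formOverlap hm (hi.2 φ)⟩) (Set.toFinite _)))⟩
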